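/- Let $d\ge 1$ be an integer and let $\alpha,\beta>0$. For a finite non-negative Borel measure $\mu$ on $\mathbb{R}^d$ write $$\widehat{\mu}(\xi)=\int_{\mathbb{R}^d} e^{-2\pi i\langle x,\xi\rangle}\,d\mu(x),$$ and, for $\mu\neq 0$, define $$C_{\alpha,\beta,d}(\mu)=\frac{\big\|\widehat{\mu}(\xi)|\xi|^\beta\big\|_\infty^{\alpha}\,\big(\int |x|^\alpha\,d\mu\big)^{\beta}}{\mu(\mathbb{R}^d)^{\alpha+\beta}}\in[0,\infty]$$ if $\|\widehat{\mu}(\xi)|\xi|^\beta\|_\infty<\infty$, and $C_{\alpha,\beta,d}(\mu)=\infty$ otherwise. Let $$C^*_{\alpha,\beta,d}=\inf_{\mu} C_{\alpha,\beta,d}(\mu),$$ where the infimum is over all non-zero finite non-negative Borel measures $\mu$ on $\mathbb{R}^d$. Let $\mu^*$ be a non-zero finite non-negative Borel measure on $\mathbb{R}^d$ which is radial (that is, invariant under every orthogonal transformation of $\mathbb{R}^d$) and satisfies $C_{\alpha,\beta,d}(\mu^*)=C^*_{\alpha,\beta,d}$. Then $$0<\limsup_{|\xi|\to\infty}|\widehat{\mu^*}(\xi)|\,|\xi|^{\gamma}<\infty,$$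 where $\gamma=\beta$ if $\beta\ge\frac{d-1}{2}$; and if $\beta<\frac{d-1}{2}$, this holds for at least one $\gamma\in\{\beta,\frac{d-1}{2}\}$. -/

import Mathlib

open MeasureTheory Filter Bornology
open scoped ENNReal RealInnerProductSpace

noncomputable section

namespace FourierUncertainty

/-- The Fourier transform of a (finite) measure on `ℝᵈ`:
`μ̂(ξ) = ∫ exp(-2πi⟨x, ξ⟩) dμ(x)`. -/
def measureFourier {d : ℕ} (μ : Measure (EuclideanSpace ℝ (Fin d)))
    (ξ : EuclideanSpace ℝ (Fin d)) : ℂ :=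
  ∫ x, Complex.exp (-2 * Real.pi * Complex.I * ((⟪x, ξ⟫ : ℝ) : ℂ)) ∂μ

/-- A measure on `ℝᵈ` is radial if it is invariant under every element of `O(d)`. -/
def IsRadial {d : ℕ} (μ : Measure (EuclideanSpace ℝ (Fin d))) : Prop :=
  ∀ R : EuclideanSpace ℝ (Fin d) ≃ₗᵢ[ℝ] EuclideanSpace ℝ (Fin d), μ.map R = μ

/-- The norm `‖ μ̂(ξ) |ξ|^β ‖_∞`, as an extended non-negative number. -/
def weightedSupNorm {d : ℕ} (β : ℝ) (μ : Measure (EuclideanSpace ℝ (Fin d))) : ℝ≥0∞ :=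
  eLpNorm (fun ξ => measureFourier μ ξ * ((‖ξ‖ ^ β : ℝ) : ℂ)) ∞ volume

/-- The moment `∫ |x|^α dμ`, as an extended non-negative number. -/
def moment {d : ℕ} (α : ℝ) (μ : Measure (EuclideanSpace ℝ (Fin d))) : ℝ≥0∞ :=
  ∫⁻ x, ENNReal.ofReal (‖x‖ ^ α) ∂μ

open Classical in
/-- The functional
`C_{α,β,d}(μ) = ‖μ̂(ξ)|ξ|^β‖_∞^α (∫ |x|^α dμ)^β / ‖μ‖_TV^(α+β)` for a non-negative measure `μ`
(so that `‖μ‖_TV = μ(ℝᵈ)`); it is `∞` by convention when the first norm is infinite. -/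
def uncertaintyQuotient {d : ℕ} (α β : ℝ) (μ : Measure (EuclideanSpace ℝ (Fin d))) : ℝ≥0∞ :=
  if weightedSupNorm β μ = ∞ then ∞
  else weightedSupNorm β μ ^ α * moment α μ ^ β / μ Set.univ ^ (α + β)

/-- The optimal constant `C*_{α,β,d}`: the infimum of `C_{α,β,d}` over all non-zero finite
non-negative Borel measures on `ℝᵈ`. -/
def optimalConstant (α β : ℝ) (d : ℕ) : ℝ≥0∞ :=
  ⨅ (μ : Measure (EuclideanSpace ℝ (Fin d))) (_ : IsFiniteMeasure μ) (_ : μ ≠ 0),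
    uncertaintyQuotient α β μ

/-- `limsup_{|ξ| → ∞} |μ̂(ξ)| |ξ|^γ`, as an extended non-negative number. -/
def decayLimsup {d : ℕ} (μ : Measure (EuclideanSpace ℝ (Fin d))) (γ : ℝ) : ℝ≥0∞ :=
  limsup (fun ξ => ENNReal.ofReal (‖measureFourier μ ξ‖ * ‖ξ‖ ^ γ))
    (cobounded (EuclideanSpace ℝ (Fin d)))

end FourierUncertainty

end

/-! Finiteness of the limsup with exponent `β` is immediate, since the extremizer has a finite
weighted sup norm `M`. If that limsup is also positive, nothing remains to prove. The content is the
case where it vanishes, so that `|μ̂(ξ)||ξ|^β → 0`; then the set `K` where this quantity is at least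
`M / 2` is compact.

Compactness of `K` permits a first variation. Perturb `μ` to `(1 + t f) μ`. If `f` keeps the
mass-moment part of the quotient stationary, the weighted transform of `(1 + f) μ` cannot be below
`M` in absolute value on all of `K` (`exists_le_perturbation`). Hahn–Banach in `C(K, ℝ)` turns this
into a multiplier `Λ`, and testing against cosines gives, `μ`-almost everywhere, `Λ(w(ξ) cos 2π⟨x,
ξ⟩) + b|x|^α = a`, with `w(ξ) = |ξ|^β` and `b ≠ 0` (`exists_multiplier`). Along a ray the first term
is bounded and real analytic in the radius, so it can balance `a - b r^α` only at finitely many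
radii (`finite_zeros_add_rpow`). By radiality `μ` lives on finitely many spheres and possibly the
origin (`exists_finite_spheres`).

On a sphere of radius `r` the transform solves Bessel's equation (`sphere_ode`), hence after
multiplication by `ρ^((d-1)/2)` it is asymptotic to a sinusoid of frequency `r`, nonzero if the
sphere carries mass (`exists_bessel_asymptotics`). Sinusoids of distinct frequencies cannot cancel
at infinity (`eq_zero_of_tendsto_sum_oscillations`), and decay of `μ̂` excludes an atom at the
origin. So the exact decay exponent is `(d-1)/2`. This is incompatible with a vanishing `β`-limsup
when `β ≥ (d-1)/2`, and is the second alternative otherwise. -/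

noncomputable section

namespace FourierUncertainty

/-! ### Radial measures and cosine transforms -/

variable {d : ℕ} {μ : Measure (EuclideanSpace ℝ (Fin d))}

/-- The weighted cosine transform `∫ f(x) cos(2π⟨x, ξ⟩) dμ(x)`. -/
def cosTransform (μ : Measure (EuclideanSpace ℝ (Fin d))) (f : EuclideanSpace ℝ (Fin d) → ℝ)
    (ξ : EuclideanSpace ℝ (Fin d)) : ℝ :=
  ∫ x, f x * Real.cos (2 * Real.pi * ⟪x, ξ⟫) ∂μ

theorem IsRadial.measurePreserving (h : IsRadial μ)
    (R : EuclideanSpace ℝ (Fin d) ≃ₗᵢ[ℝ] EuclideanSpace ℝ (Fin d)) :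
    MeasurePreserving R μ μ :=
  ⟨R.continuous.measurable, h R⟩

theorem IsRadial.integral_comp (h : IsRadial μ)
    (R : EuclideanSpace ℝ (Fin d) ≃ₗᵢ[ℝ] EuclideanSpace ℝ (Fin d))
    {F : Type*} [NormedAddCommGroup F] [NormedSpace ℝ F] (f : EuclideanSpace ℝ (Fin d) → F) :
    ∫ x, f (R x) ∂μ = ∫ x, f x ∂μ :=
  (h.measurePreserving R).integral_comp R.toHomeomorph.measurableEmbedding f

theorem IsRadial.integral_odd (h : IsRadial μ) {F : Type*} [NormedAddCommGroup F]
    [NormedSpace ℝ F] {f : EuclideanSpace ℝ (Fin d) → F} (hf : ∀ x, f (-x) = - f x) :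
    ∫ x, f x ∂μ = 0 := by
  have h1 := h.integral_comp (LinearIsometryEquiv.neg ℝ) f
  simp only [LinearIsometryEquiv.coe_neg, hf, integral_neg] at h1
  have h2 : (2 : ℝ) • ∫ x, f x ∂μ = 0 := by
    rw [two_smul]; nth_rewrite 1 [← h1]; simp
  simpa using h2

theorem integrable_mul_cos {f : EuclideanSpace ℝ (Fin d) → ℝ} (hf : Integrable f μ)
    (ξ : EuclideanSpace ℝ (Fin d)) :
    Integrable (fun x => f x * Real.cos (2 * Real.pi * ⟪x, ξ⟫)) μ := by
  refine hf.mul_bdd (c := 1) (by fun_prop) (.of_forall fun x => ?_)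
  simpa using Real.abs_cos_le_one _

theorem integrable_mul_sin {f : EuclideanSpace ℝ (Fin d) → ℝ} (hf : Integrable f μ)
    (ξ : EuclideanSpace ℝ (Fin d)) :
    Integrable (fun x => f x * Real.sin (2 * Real.pi * ⟪x, ξ⟫)) μ := by
  refine hf.mul_bdd (c := 1) (by fun_prop) (.of_forall fun x => ?_)
  simpa using Real.abs_sin_le_one _

theorem continuous_cosTransform {f : EuclideanSpace ℝ (Fin d) → ℝ} (hf : Integrable f μ) :
    Continuous (cosTransform μ f) := by
  refine continuous_of_dominated (bound := fun x => |f x|)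
    (fun ξ => (integrable_mul_cos hf ξ).aestronglyMeasurable)
    (fun ξ => .of_forall fun x => ?_) hf.abs (.of_forall fun x => by fun_prop)
  rw [norm_mul]
  exact mul_le_of_le_one_right (norm_nonneg _) (Real.abs_cos_le_one _)

theorem abs_cosTransform_le {f : EuclideanSpace ℝ (Fin d) → ℝ} (hf : Integrable f μ)
    (ξ : EuclideanSpace ℝ (Fin d)) : |cosTransform μ f ξ| ≤ ∫ x, |f x| ∂μ := by
  rw [← Real.norm_eq_abs, cosTransform]
  refine norm_integral_le_of_norm_le hf.abs (.of_forall fun x => ?_)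
  rw [norm_mul]
  exact mul_le_of_le_one_right (norm_nonneg _) (Real.abs_cos_le_one _)

/-- Radiality includes invariance under `x ↦ -x`, which kills the sine part; everything later is
therefore real-valued. -/
theorem IsRadial.integral_mul_exp (h : IsRadial μ) {f : EuclideanSpace ℝ (Fin d) → ℝ}
    (hf : Integrable f μ) (heven : ∀ x, f (-x) = f x) (ξ : EuclideanSpace ℝ (Fin d)) :
    ∫ x, (f x : ℂ) * Complex.exp (-2 * Real.pi * Complex.I * ((⟪x, ξ⟫ : ℝ) : ℂ)) ∂μ =
      (cosTransform μ f ξ : ℂ) := by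
  have key : ∀ x : EuclideanSpace ℝ (Fin d),
      (f x : ℂ) * Complex.exp (-2 * Real.pi * Complex.I * ((⟪x, ξ⟫ : ℝ) : ℂ)) =
      ((f x * Real.cos (2 * Real.pi * ⟪x, ξ⟫) : ℝ) : ℂ) +
        (-Complex.I) * ((f x * Real.sin (2 * Real.pi * ⟪x, ξ⟫) : ℝ) : ℂ) := by
    intro x
    have : -2 * Real.pi * Complex.I * ((⟪x, ξ⟫ : ℝ) : ℂ) =
        ((-(2 * Real.pi * ⟪x, ξ⟫) : ℝ) : ℂ) * Complex.I := by push_cast; ring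
    rw [this, Complex.exp_mul_I, ← Complex.ofReal_cos, ← Complex.ofReal_sin, Real.cos_neg,
      Real.sin_neg]
    push_cast; ring
  simp_rw [key]
  rw [integral_add (integrable_mul_cos hf ξ).ofReal
    ((integrable_mul_sin hf ξ).ofReal.const_mul _), integral_const_mul, integral_complex_ofReal,
    integral_complex_ofReal, h.integral_odd (f := fun x => f x * Real.sin (2 * Real.pi * ⟪x, ξ⟫))]
  · simp [cosTransform]
  · intro x; simp [heven]

theorem IsRadial.measureFourier_withDensity (h : IsRadial μ) {f : EuclideanSpace ℝ (Fin d) → ℝ}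
    (hf : Integrable f μ) (hm : Measurable f) (hpos : ∀ x, 0 ≤ f x) (heven : ∀ x, f (-x) = f x)
    (ξ : EuclideanSpace ℝ (Fin d)) :
    measureFourier (μ.withDensity fun x => ENNReal.ofReal (f x)) ξ = (cosTransform μ f ξ : ℂ) := by
  rw [← h.integral_mul_exp hf heven, measureFourier,
    integral_withDensity_eq_integral_toReal_smul (by fun_prop) (by simp)]
  simp [hpos]

theorem IsRadial.measureFourier_eq [IsFiniteMeasure μ] (h : IsRadial μ)
    (ξ : EuclideanSpace ℝ (Fin d)) :
    measureFourier μ ξ = (cosTransform μ (fun _ => 1) ξ : ℂ) := by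
  rw [← h.integral_mul_exp (integrable_const _) (fun _ => rfl)]
  simp [measureFourier]

theorem continuous_measureFourier [IsFiniteMeasure μ] : Continuous (measureFourier μ) := by
  refine continuous_of_dominated (bound := fun x => 1) (fun ξ => by fun_prop)
    (fun ξ => .of_forall fun x => ?_) (integrable_const _) (.of_forall fun x => by fun_prop)
  have : -2 * Real.pi * Complex.I * ((⟪x, ξ⟫ : ℝ) : ℂ) =
        ((-(2 * Real.pi * ⟪x, ξ⟫) : ℝ) : ℂ) * Complex.I := by push_cast; ring
  rw [this, Complex.norm_exp_ofReal_mul_I]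

/-! ### The uncertainty quotient in real terms, and its finite infimum -/

theorem weightedSupNorm_le {β B : ℝ}
    (hB : ∀ ξ, ‖measureFourier μ ξ‖ * ‖ξ‖ ^ β ≤ B) : weightedSupNorm β μ ≤ ENNReal.ofReal B := by
  refine eLpNormEssSup_le_of_ae_bound (.of_forall fun ξ => ?_)
  rw [norm_mul, Complex.norm_real, Real.norm_of_nonneg (by positivity)]
  exact hB ξ

/-- The essential supremum is a genuine one: the weighted transform is continuous (at the origin
because `β > 0`), and a closed set of full Lebesgue measure is everything. -/
theorem norm_measureFourier_mul_le [IsFiniteMeasure μ] {β : ℝ} (hβ : 0 < β)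
    (hfin : weightedSupNorm β μ ≠ ∞) (ξ : EuclideanSpace ℝ (Fin d)) :
    ‖measureFourier μ ξ‖ * ‖ξ‖ ^ β ≤ (weightedSupNorm β μ).toReal := by
  have hc : Continuous (fun ξ => measureFourier μ ξ * ((‖ξ‖ ^ β : ℝ) : ℂ)) := by
    have := continuous_measureFourier (μ := μ)
    have h2 : Continuous fun ξ : EuclideanSpace ℝ (Fin d) => ‖ξ‖ ^ β :=
      continuous_norm.rpow_const fun _ => Or.inr hβ.le
    fun_prop
  have hae : ∀ᵐ ξ ∂(volume : Measure (EuclideanSpace ℝ (Fin d))),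
      ‖measureFourier μ ξ * ((‖ξ‖ ^ β : ℝ) : ℂ)‖ ≤ (weightedSupNorm β μ).toReal := by
    filter_upwards [enorm_ae_le_eLpNormEssSup
      (fun ξ => measureFourier μ ξ * ((‖ξ‖ ^ β : ℝ) : ℂ)) volume] with ξ hξ
    rw [← toReal_enorm]
    refine ENNReal.toReal_mono hfin ?_
    simpa [weightedSupNorm] using hξ
  have hd : Dense {ξ | ‖measureFourier μ ξ * ((‖ξ‖ ^ β : ℝ) : ℂ)‖ ≤
      (weightedSupNorm β μ).toReal} := Measure.dense_of_ae hae
  have hcl : IsClosed {ξ | ‖measureFourier μ ξ * ((‖ξ‖ ^ β : ℝ) : ℂ)‖ ≤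
      (weightedSupNorm β μ).toReal} := isClosed_le hc.norm continuous_const
  have h3 : ξ ∈ {ξ | ‖measureFourier μ ξ * ((‖ξ‖ ^ β : ℝ) : ℂ)‖ ≤
      (weightedSupNorm β μ).toReal} := by
    rw [← hcl.closure_eq]; exact hd ξ
  simpa [norm_mul, abs_of_nonneg (Real.rpow_nonneg (norm_nonneg ξ) β)] using h3

theorem measureFourier_zero : measureFourier μ 0 = ((μ.real Set.univ : ℝ) : ℂ) := by
  simp [measureFourier]

/-- At the origin the transform is the total mass, so it is nonzero at nearby points `ξ ≠ 0`; such
points exist because `d ≥ 1`. -/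
theorem weightedSupNorm_toReal_pos [IsFiniteMeasure μ] (hd : 1 ≤ d) (hμ : μ ≠ 0) {β : ℝ}
    (hβ : 0 < β) (hfin : weightedSupNorm β μ ≠ ∞) : 0 < (weightedSupNorm β μ).toReal := by
  have h0 : measureFourier μ 0 ≠ 0 := by
    rw [measureFourier_zero]
    simpa [measureReal_eq_zero_iff] using hμ
  have : NeZero d := ⟨by omega⟩
  have hev : ∀ᶠ ξ in nhds (0 : EuclideanSpace ℝ (Fin d)), measureFourier μ ξ ≠ 0 :=
    continuous_measureFourier.continuousAt.eventually_ne h0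
  have : (nhdsWithin (0 : EuclideanSpace ℝ (Fin d)) {0}ᶜ).NeBot := by
    have : Nontrivial (EuclideanSpace ℝ (Fin d)) := inferInstance
    exact Module.punctured_nhds_neBot ℝ _ _
  obtain ⟨ξ, h1, h2⟩ := ((hev.filter_mono nhdsWithin_le_nhds).and
    (self_mem_nhdsWithin (a := (0 : EuclideanSpace ℝ (Fin d))) (s := {0}ᶜ))).exists
  refine lt_of_lt_of_le ?_ (norm_measureFourier_mul_le hβ hfin ξ)
  have : 0 < ‖ξ‖ := norm_pos_iff.2 h2
  have : 0 < ‖measureFourier μ ξ‖ := norm_pos_iff.2 h1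
  positivity

theorem uncertaintyQuotient_le {α β B m V : ℝ} (hα : 0 < α) (hβ : 0 < β)
    (hB0 : 0 ≤ B) (hm0 : 0 ≤ m) (hV : 0 < V)
    (hB : ∀ ξ, ‖measureFourier μ ξ‖ * ‖ξ‖ ^ β ≤ B)
    (hm : moment α μ = ENNReal.ofReal m) (hVμ : μ Set.univ = ENNReal.ofReal V) :
    uncertaintyQuotient α β μ ≤ ENNReal.ofReal (B ^ α * m ^ β / V ^ (α + β)) := by
  have h1 := weightedSupNorm_le hB
  rw [uncertaintyQuotient, if_neg (ne_top_of_le_ne_top ENNReal.ofReal_ne_top h1), hm, hVμ,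
    ENNReal.ofReal_div_of_pos (by positivity), ENNReal.ofReal_mul (by positivity),
    ENNReal.ofReal_rpow_of_nonneg hm0 hβ.le, ENNReal.ofReal_rpow_of_pos hV,
    ← ENNReal.ofReal_rpow_of_nonneg hB0 hα.le]
  gcongr

theorem integrable_norm_rpow_stdGaussian {α : ℝ} (hα : 0 < α) :
    Integrable (fun x : EuclideanSpace ℝ (Fin d) => ‖x‖ ^ α)
      (ProbabilityTheory.stdGaussian (EuclideanSpace ℝ (Fin d))) := by
  have h := (ProbabilityTheory.IsGaussian.memLp_id
    (ProbabilityTheory.stdGaussian (EuclideanSpace ℝ (Fin d))) (ENNReal.ofReal α)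
    (by simp)).integrable_norm_rpow (by simpa using hα) (by simp)
  simpa [ENNReal.toReal_ofReal hα.le] using h

theorem measureFourier_eq_charFun (ξ : EuclideanSpace ℝ (Fin d)) :
    measureFourier μ ξ = charFun μ (-(2 * Real.pi) • ξ) := by
  rw [charFun_apply, measureFourier]
  congr 1 with x
  rw [real_inner_smul_right]
  push_cast; ring_nf

/-- The standard Gaussian is a competitor with finite quotient. This forces an extremizer to have
finite weighted sup norm and finite moment. -/
theorem optimalConstant_lt_top {α β : ℝ} (hα : 0 < α) (hβ : 0 < β) :
    optimalConstant α β d < ∞ := by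
  set ν := ProbabilityTheory.stdGaussian (EuclideanSpace ℝ (Fin d)) with hν
  obtain ⟨B, hB⟩ : ∃ B, ∀ ξ, ‖measureFourier ν ξ‖ * ‖ξ‖ ^ β ≤ B := by
    -- From `β log x ≤ β x ≤ (β² + x²) / 2`, the quadratic term being absorbed by the Gaussian
    -- exponent `-2π²x²`.
    refine ⟨Real.exp (β ^ 2), fun ξ => ?_⟩
    have hn : ‖measureFourier ν ξ‖ = Real.exp (-(2 * Real.pi ^ 2 * ‖ξ‖ ^ 2)) := by
      rw [measureFourier_eq_charFun, hν, ProbabilityTheory.charFun_stdGaussian, norm_smul,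
        norm_neg, Real.norm_of_nonneg Real.two_pi_pos.le]
      have : (-((2 * Real.pi * ‖ξ‖ : ℝ) : ℂ) ^ 2 / 2) =
          ((-(2 * Real.pi ^ 2 * ‖ξ‖ ^ 2) : ℝ) : ℂ) := by push_cast; ring
      rw [this, ← Complex.ofReal_exp, Complex.norm_real, Real.norm_of_nonneg (Real.exp_pos _).le]
    rw [hn]
    rcases (norm_nonneg ξ).eq_or_lt with h0 | h0
    · rw [← h0, Real.zero_rpow hβ.ne', mul_zero]; positivity
    · rw [Real.rpow_def_of_pos h0, ← Real.exp_add, Real.exp_le_exp]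
      have h1 := Real.log_le_self h0.le
      have h2 := mul_le_mul_of_nonneg_right h1 hβ.le
      have h3 : (1 : ℝ) ≤ Real.pi ^ 2 := by nlinarith [Real.pi_gt_three]
      have h4 := mul_le_mul_of_nonneg_right h3 (sq_nonneg ‖ξ‖)
      nlinarith [sq_nonneg (β - ‖ξ‖)]
  have h1 : optimalConstant α β d ≤ uncertaintyQuotient α β ν :=
    iInf_le_of_le ν (iInf_le_of_le inferInstance (iInf_le _ (IsProbabilityMeasure.ne_zero ν)))
  refine (h1.trans (uncertaintyQuotient_le (B := max B 0) (m := ∫ x, ‖x‖ ^ α ∂ν) (V := 1) hα hβ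
    (le_max_right _ _) (integral_nonneg fun x => by positivity) one_pos
    (fun ξ => (hB ξ).trans (le_max_left _ _)) ?_ (by simp [hν]))).trans_lt ENNReal.ofReal_lt_top
  rw [moment, ofReal_integral_eq_lintegral_ofReal (integrable_norm_rpow_stdGaussian hα)
    (.of_forall fun x => by positivity)]

/-! ### First variation of the quotient -/

/-- By `hL` the moment and mass terms cancel in the logarithmic derivative at `t = 0`, leaving `-α c
/ M < 0`. -/
theorem eventually_quotient_lt {α β M m V m' V' c : ℝ} (hα : 0 < α)
    (hM : 0 < M) (hm : 0 < m) (hV : 0 < V) (hc : 0 < c)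
    (hL : β * m' / m = (α + β) * V' / V) :
    ∀ᶠ t in nhdsWithin (0 : ℝ) (Set.Ioi 0),
      (M - t * c) ^ α * (m + t * m') ^ β / (V + t * V') ^ (α + β) <
        M ^ α * m ^ β / V ^ (α + β) := by
  have hlin : ∀ a b : ℝ, HasDerivAt (fun t : ℝ => a + t * b) b 0 := fun a b => by
    simpa using ((hasDerivAt_id (0 : ℝ)).mul_const b).const_add a
  have hpos : ∀ a b : ℝ, 0 < a → ∀ᶠ t in nhdsWithin (0 : ℝ) (Set.Ioi 0), 0 < a + t * b :=
    fun a b ha => ((hlin a b).continuousAt.eventually_const_lt (by simpa using ha)).filter_mono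
      nhdsWithin_le_nhds
  set φ : ℝ → ℝ := fun t => α * Real.log (M + t * (-c)) + β * Real.log (m + t * m') -
    (α + β) * Real.log (V + t * V') with hφ
  have hd : HasDerivAt φ (-(α * c / M)) 0 := by
    have h1 := (((hlin M (-c)).log (by simpa using hM.ne')).const_mul α).add
      (((hlin m m').log (by simpa using hm.ne')).const_mul β)
    have h2 := h1.sub (((hlin V V').log (by simpa using hV.ne')).const_mul (α + β))
    refine h2.congr_deriv ?_
    simp only [zero_mul, add_zero]
    rw [← mul_div_assoc, ← mul_div_assoc, ← mul_div_assoc, hL]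
    ring
  have hneg : -(α * c / M) < 0 := by rw [neg_lt_zero]; positivity
  have hslope : ∀ᶠ t in nhdsWithin (0 : ℝ) (Set.Ioi 0), slope φ 0 t < 0 :=
    ((hasDerivAt_iff_tendsto_slope.1 hd).eventually (gt_mem_nhds hneg)).filter_mono
      (nhdsWithin_mono _ fun t ht => ne_of_gt ht)
  filter_upwards [hslope, hpos M (-c) hM, hpos m m' hm, hpos V V' hV, self_mem_nhdsWithin]
    with t ht hMt hmt hVt ht0
  have ht0 : 0 < t := ht0
  have hlt : φ t < φ 0 := by
    rw [slope_def_field, sub_zero, div_neg_iff] at ht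
    rcases ht with ht | ht <;> linarith
  rw [show M - t * c = M + t * (-c) by ring]
  rw [← Real.log_lt_log_iff (by positivity) (by positivity)]
  rw [Real.log_div (by positivity) (by positivity), Real.log_mul (by positivity) (by positivity),
    Real.log_rpow hMt, Real.log_rpow hmt, Real.log_rpow hVt, Real.log_div (by positivity)
    (by positivity), Real.log_mul (by positivity) (by positivity), Real.log_rpow hM,
    Real.log_rpow hm, Real.log_rpow hV]
  simpa [hφ] using hlt

theorem moment_eq_ofReal_integral {α : ℝ} (h : Integrable (fun x => ‖x‖ ^ α) μ) :
    moment α μ = ENNReal.ofReal (∫ x, ‖x‖ ^ α ∂μ) :=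
  (ofReal_integral_eq_lintegral_ofReal h (.of_forall fun x => by positivity)).symm

theorem uncertaintyQuotient_eq [IsFiniteMeasure μ] {α β : ℝ} (hα : 0 < α) (hβ : 0 < β)
    (hμ : μ ≠ 0) (hfin : weightedSupNorm β μ ≠ ∞) (h : Integrable (fun x => ‖x‖ ^ α) μ) :
    uncertaintyQuotient α β μ = ENNReal.ofReal ((weightedSupNorm β μ).toReal ^ α *
      (∫ x, ‖x‖ ^ α ∂μ) ^ β / μ.real Set.univ ^ (α + β)) := by
  have hV : 0 < μ.real Set.univ := by
    rw [measureReal_def]; exact ENNReal.toReal_pos (by simpa using hμ) (by simp)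
  have h0 : 0 ≤ ∫ x, ‖x‖ ^ α ∂μ := integral_nonneg fun x => by positivity
  rw [uncertaintyQuotient, if_neg hfin, ENNReal.ofReal_div_of_pos (by positivity),
    ENNReal.ofReal_mul (by positivity), moment_eq_ofReal_integral h,
    ENNReal.ofReal_rpow_of_nonneg h0 hβ.le, ← ENNReal.ofReal_rpow_of_pos hV,
    ← ENNReal.ofReal_rpow_of_nonneg ENNReal.toReal_nonneg hα.le, ENNReal.ofReal_toReal hfin,
    measureReal_def, ENNReal.ofReal_toReal (by simp)]

theorem cosTransform_add {f g : EuclideanSpace ℝ (Fin d) → ℝ} (hf : Integrable f μ)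
    (hg : Integrable g μ) (ξ : EuclideanSpace ℝ (Fin d)) :
    cosTransform μ (fun x => f x + g x) ξ = cosTransform μ f ξ + cosTransform μ g ξ := by
  simp only [cosTransform, add_mul]
  exact integral_add (integrable_mul_cos hf ξ) (integrable_mul_cos hg ξ)

theorem cosTransform_const_mul (c : ℝ) (f : EuclideanSpace ℝ (Fin d) → ℝ)
    (ξ : EuclideanSpace ℝ (Fin d)) :
    cosTransform μ (fun x => c * f x) ξ = c * cosTransform μ f ξ := by
  simp only [cosTransform, mul_assoc]
  exact integral_const_mul _ _

/-- An admissible first-order perturbation of an extremizer which preserves the scale-invariant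
combination of mass and moment cannot lower the sup norm on the set of near-maximum points. -/
theorem IsRadial.exists_le_perturbation [IsFiniteMeasure μ] {α β : ℝ} (hα : 0 < α) (hβ : 0 < β)
    (hrad : IsRadial μ) (hμ : μ ≠ 0) {M : ℝ} (hM : 0 < M)
    (hMμ : M = (weightedSupNorm β μ).toReal)
    (hfin : weightedSupNorm β μ ≠ ∞) (hint : Integrable (fun x => ‖x‖ ^ α) μ)
    (hmpos : 0 < ∫ x, ‖x‖ ^ α ∂μ)
    (hext : uncertaintyQuotient α β μ = optimalConstant α β d)
    (hK : IsCompact {ξ | M / 2 ≤ |cosTransform μ (fun _ => 1) ξ * ‖ξ‖ ^ β|})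
    {f : EuclideanSpace ℝ (Fin d) → ℝ} (hf : Continuous f) (heven : ∀ x, f (-x) = f x)
    {B C : ℝ} (hB : ∀ x, |f x| ≤ B) (hC : ∀ ξ, |cosTransform μ f ξ * ‖ξ‖ ^ β| ≤ C)
    (hL : β * (∫ x, f x * ‖x‖ ^ α ∂μ) / (∫ x, ‖x‖ ^ α ∂μ) =
      (α + β) * (∫ x, f x ∂μ) / μ.real Set.univ) :
    ∃ ξ, M / 2 ≤ |cosTransform μ (fun _ => 1) ξ * ‖ξ‖ ^ β| ∧
      M ≤ |cosTransform μ (fun _ => 1) ξ * ‖ξ‖ ^ β + cosTransform μ f ξ * ‖ξ‖ ^ β| := by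
  by_contra! hcon
  have hV : 0 < μ.real Set.univ := by
    rw [measureReal_def]; exact ENNReal.toReal_pos (by simpa using hμ) (by simp)
  have hB0 : 0 ≤ B := (abs_nonneg _).trans (hB 0)
  have hC0 : 0 ≤ C := (abs_nonneg _).trans (hC 0)
  have hfint : Integrable f μ :=
    (integrable_const B).mono' hf.aestronglyMeasurable (.of_forall hB)
  have hfmint : Integrable (fun x => f x * ‖x‖ ^ α) μ :=
    hint.bdd_mul (c := B) hf.aestronglyMeasurable (.of_forall hB)
  have hw : Continuous fun ξ : EuclideanSpace ℝ (Fin d) => ‖ξ‖ ^ β :=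
    continuous_norm.rpow_const fun _ => Or.inr hβ.le
  have hh : ∀ ξ, |cosTransform μ (fun _ => 1) ξ * ‖ξ‖ ^ β| ≤ M := by
    intro ξ
    have := norm_measureFourier_mul_le hβ hfin ξ
    rw [hrad.measureFourier_eq, Complex.norm_real, Real.norm_eq_abs, ← hMμ] at this
    rwa [abs_mul, abs_of_nonneg (Real.rpow_nonneg (norm_nonneg ξ) β)]
  -- On the compact set a strict pointwise inequality improves to a uniform gap `c`; if the set is
  -- empty any gap will do.
  obtain ⟨c, hc, hcK⟩ : ∃ c, 0 < c ∧ ∀ ξ, M / 2 ≤ |cosTransform μ (fun _ => 1) ξ * ‖ξ‖ ^ β| →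
      |cosTransform μ (fun _ => 1) ξ * ‖ξ‖ ^ β + cosTransform μ f ξ * ‖ξ‖ ^ β| ≤ M - c := by
    rcases Set.eq_empty_or_nonempty
      {ξ | M / 2 ≤ |cosTransform μ (fun _ => 1) ξ * ‖ξ‖ ^ β|} with h | h
    · exact ⟨1, one_pos, fun ξ hξ => absurd (h ▸ hξ : ξ ∈ (∅ : Set _)) (Set.notMem_empty ξ)⟩
    · have hc1 := continuous_cosTransform (μ := μ) (f := fun _ => 1) (integrable_const 1)
      have hc2 := continuous_cosTransform hfint
      obtain ⟨ξ₀, h0, h1⟩ := hK.exists_isMaxOn h (f := fun ξ =>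
        |cosTransform μ (fun _ => 1) ξ * ‖ξ‖ ^ β + cosTransform μ f ξ * ‖ξ‖ ^ β|)
        (by fun_prop)
      exact ⟨_, sub_pos.2 (hcon ξ₀ h0), fun ξ hξ => by simpa using h1 hξ⟩
  have hev1 : ∀ D : ℝ, ∀ a : ℝ, 0 < a → ∀ᶠ t in nhdsWithin (0 : ℝ) (Set.Ioi 0), t * D < a := by
    intro D a ha
    have : ContinuousAt (fun t : ℝ => t * D) 0 := by fun_prop
    exact (this.eventually_lt_const (by simpa using ha)).filter_mono nhdsWithin_le_nhds
  -- The smallness conditions on `t` give, in turn: a strict drop of the quotient, a nonnegative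
  -- density, control of the transform off the near-maximum set, positive mass, and `t < 1` for a
  -- convex combination.
  obtain ⟨t, hlt, htB, htC, htV, ht1, ht0⟩ := ((eventually_quotient_lt hα hM hmpos hV hc hL).and
    ((hev1 B 1 one_pos).and ((hev1 (C + c) (M / 2) (by positivity)).and
    ((hev1 (-∫ x, f x ∂μ) _ hV).and ((hev1 1 1 one_pos).and self_mem_nhdsWithin))))).exists
  have ht0 : 0 < t := ht0
  have hpos : ∀ x, 0 ≤ 1 + t * f x := fun x => by
    have := mul_le_mul_of_nonneg_left (hB x) ht0.le
    have h2 := neg_abs_le (t * f x)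
    rw [abs_mul, abs_of_pos ht0] at h2
    linarith
  have hgint : Integrable (fun x => 1 + t * f x) μ :=
    (integrable_const 1).add (hfint.const_mul t)
  have hgm : Measurable (fun x => 1 + t * f x) := (by fun_prop : Continuous _).measurable
  set ν := μ.withDensity fun x => ENNReal.ofReal (1 + t * f x) with hν
  have hFT : ∀ ξ, ‖measureFourier ν ξ‖ * ‖ξ‖ ^ β ≤ M - t * c := by
    intro ξ
    rw [hν, hrad.measureFourier_withDensity hgint hgm hpos (by simp [heven]), Complex.norm_real,
      Real.norm_eq_abs, ← abs_of_nonneg (Real.rpow_nonneg (norm_nonneg ξ) β), ← abs_mul,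
      cosTransform_add (integrable_const 1) (hfint.const_mul t), cosTransform_const_mul]
    have hhξ := hh ξ
    have hCξ := hC ξ
    have hKξ := hcK ξ
    have hrw : (cosTransform μ (fun _ => 1) ξ + t * cosTransform μ f ξ) * ‖ξ‖ ^ β =
        cosTransform μ (fun _ => 1) ξ * ‖ξ‖ ^ β + t * (cosTransform μ f ξ * ‖ξ‖ ^ β) := by ring
    rw [hrw]
    generalize cosTransform μ (fun _ => 1) ξ * ‖ξ‖ ^ β = a at hhξ hKξ ⊢
    generalize cosTransform μ f ξ * ‖ξ‖ ^ β = k at hCξ hKξ ⊢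
    by_cases hξ : M / 2 ≤ |a|
    · have h1 := hKξ hξ
      -- Near the maximum, convexity interpolates between the bounds `M` at `t = 0` and `M - c` at
      -- `t = 1`.
      have h2 : a + t * k = (1 - t) * a + t * (a + k) := by ring
      rw [h2]
      refine (abs_add_le _ _).trans ?_
      rw [abs_mul, abs_mul, abs_of_pos ht0, abs_of_nonneg (by linarith : 0 ≤ 1 - t)]
      have h3 := mul_le_mul_of_nonneg_left hhξ (by linarith : 0 ≤ 1 - t)
      have h4 := mul_le_mul_of_nonneg_left h1 ht0.le
      linarith
    · refine (abs_add_le _ _).trans ?_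
      rw [abs_mul, abs_of_pos ht0]
      have := mul_le_mul_of_nonneg_left hCξ ht0.le
      push Not at hξ
      linarith
  have hνV : ν Set.univ = ENNReal.ofReal (μ.real Set.univ + t * ∫ x, f x ∂μ) := by
    rw [hν, withDensity_apply _ MeasurableSet.univ, Measure.restrict_univ,
      ← ofReal_integral_eq_lintegral_ofReal hgint (.of_forall hpos),
      integral_add (integrable_const 1) (hfint.const_mul t), integral_const_mul]
    simp
  have hVt : 0 < μ.real Set.univ + t * ∫ x, f x ∂μ := by linarith
  have hmint : Integrable (fun x => (1 + t * f x) * ‖x‖ ^ α) μ := by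
    simp only [add_mul, one_mul, mul_assoc]
    exact hint.add (hfmint.const_mul t)
  have hmeq : ∫ x, (1 + t * f x) * ‖x‖ ^ α ∂μ =
      ∫ x, ‖x‖ ^ α ∂μ + t * ∫ x, f x * ‖x‖ ^ α ∂μ := by
    simp only [add_mul, one_mul, mul_assoc]
    rw [integral_add hint (hfmint.const_mul t), integral_const_mul]
  have hνm : moment α ν = ENNReal.ofReal (∫ x, ‖x‖ ^ α ∂μ + t * ∫ x, f x * ‖x‖ ^ α ∂μ) := by
    have hwα : Measurable fun x : EuclideanSpace ℝ (Fin d) => ENNReal.ofReal (‖x‖ ^ α) := by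
      fun_prop
    rw [moment, hν, lintegral_withDensity_eq_lintegral_mul _ hgm.ennreal_ofReal hwα, ← hmeq,
      ofReal_integral_eq_lintegral_ofReal hmint (.of_forall fun x =>
        mul_nonneg (hpos x) (by positivity))]
    refine lintegral_congr fun x => ?_
    rw [Pi.mul_apply, ENNReal.ofReal_mul (hpos x)]
  have hνfin : IsFiniteMeasure ν := ⟨by rw [hνV]; exact ENNReal.ofReal_lt_top⟩
  have hν0 : ν ≠ 0 := by
    intro h
    rw [h] at hνV
    have := ENNReal.ofReal_pos.2 hVt
    rw [← hνV] at this
    simp at this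
  have hle : optimalConstant α β d ≤ uncertaintyQuotient α β ν :=
    iInf_le_of_le ν (iInf_le_of_le hνfin (iInf_le _ hν0))
  have hm't : 0 ≤ ∫ x, ‖x‖ ^ α ∂μ + t * ∫ x, f x * ‖x‖ ^ α ∂μ := by
    rw [← hmeq]; exact integral_nonneg fun x => mul_nonneg (hpos x) (by positivity)
  have hMt : 0 ≤ M - t * c := by
    have := mul_nonneg ht0.le hC0
    linarith
  have h3 := (hext ▸ hle).trans (uncertaintyQuotient_le hα hβ hMt hm't hVt hFT hνm hνV)
  rw [uncertaintyQuotient_eq hα hβ hμ hfin hint, ← hMμ, ENNReal.ofReal_le_ofReal_iff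
    (by positivity)] at h3
  exact absurd hlt (not_lt.2 h3)

/-! ### Lagrange multiplier and Euler–Lagrange equation -/

/-- A Lagrange multiplier for minimizing the norm over an affine subspace. -/
theorem exists_clm_pos_of_le_norm {S X : Type*} [AddCommGroup S] [Module ℝ S]
    [NormedAddCommGroup X] [NormedSpace ℝ X] (T : S →ₗ[ℝ] X) (L : S →ₗ[ℝ] ℝ) (h : X) {M : ℝ}
    (hM : 0 < M) (hT : ∀ f, L f = 0 → M ≤ ‖h + T f‖) :
    ∃ Λ : X →L[ℝ] ℝ, 0 < Λ h ∧ ∀ f, L f = 0 → Λ (T f) = 0 := by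
  have hconv : Convex ℝ ((fun f => h + T f) '' (LinearMap.ker L : Set S)) := by
    have : (fun f => h + T f) '' (LinearMap.ker L : Set S) =
        (fun y => h + y) '' (((LinearMap.ker L).map T : Submodule ℝ X) : Set X) := by
      rw [Submodule.map_coe, Set.image_image]
    rw [this]
    exact (Submodule.convex _).translate h
  -- Separate the open ball of radius `M` from the affine subspace `h + T (ker L)`. A functional
  -- bounded below on an affine subspace vanishes on its directions.
  obtain ⟨Λ, u, h1, h2⟩ := geometric_hahn_banach_open (convex_ball (0 : X) M) Metric.isOpen_ball
    hconv (by
      rw [Set.disjoint_left]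
      rintro _ hx ⟨f, hf, rfl⟩
      rw [mem_ball_zero_iff] at hx
      exact absurd hx (not_lt.2 (hT f hf)))
  have hu : 0 < u := by simpa using h1 0 (Metric.mem_ball_self hM)
  have h3 : ∀ f, L f = 0 → ∀ c : ℝ, u ≤ Λ h + c * Λ (T f) := fun f hf c => by
    simpa using h2 _ ⟨c • f, by simp [hf], rfl⟩
  refine ⟨Λ, hu.trans_le (by simpa using h3 0 (map_zero L) 0), fun f hf => ?_⟩
  by_contra hne
  have := h3 f hf (-Λ h / Λ (T f))
  rw [div_mul_cancel₀ _ hne] at this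
  linarith

/-- An even integrable function all of whose cosine coefficients vanish is zero. -/
theorem IsRadial.ae_eq_zero_of_cosTransform_eq_zero (hrad : IsRadial μ)
    {g : EuclideanSpace ℝ (Fin d) → ℝ} (hg : Integrable g μ) (hgm : Measurable g)
    (heven : ∀ x, g (-x) = g x) (h0 : ∀ ξ, cosTransform μ g ξ = 0) : g =ᵐ[μ] 0 := by
  have hp : Integrable (fun x => max (g x) 0) μ := hg.pos_part
  have hn : Integrable (fun x => max (-g x) 0) μ := hg.neg_part
  have hmp : Measurable fun x => max (g x) 0 := hgm.max measurable_const
  have hmn : Measurable fun x => max (-g x) 0 := hgm.neg.max measurable_const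
  have hfp : ∫⁻ x, ENNReal.ofReal (max (g x) 0) ∂μ ≠ ∞ := by
    rw [← ofReal_integral_eq_lintegral_ofReal hp (.of_forall fun x => le_max_right _ _)]
    exact ENNReal.ofReal_ne_top
  have hfn : ∫⁻ x, ENNReal.ofReal (max (-g x) 0) ∂μ ≠ ∞ := by
    rw [← ofReal_integral_eq_lintegral_ofReal hn (.of_forall fun x => le_max_right _ _)]
    exact ENNReal.ofReal_ne_top
  have := isFiniteMeasure_withDensity hfp
  have := isFiniteMeasure_withDensity hfn
  -- The positive and negative parts of `g` define finite measures with the same characteristic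
  -- function, hence the same measure.
  have heq : μ.withDensity (fun x => ENNReal.ofReal (max (g x) 0)) =
      μ.withDensity (fun x => ENNReal.ofReal (max (-g x) 0)) := by
    refine Measure.ext_of_charFun (funext fun t => ?_)
    have ht : t = -(2 * Real.pi) • ((-(2 * Real.pi))⁻¹ • t) := by
      rw [smul_smul, mul_inv_cancel₀ (neg_ne_zero.2 Real.two_pi_pos.ne'), one_smul]
    rw [ht, ← measureFourier_eq_charFun, ← measureFourier_eq_charFun,
      hrad.measureFourier_withDensity hp hmp (fun x => le_max_right _ _) (by simp [heven]),
      hrad.measureFourier_withDensity hn hmn (fun x => le_max_right _ _) (by simp [heven])]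
    congr 1
    rw [← sub_eq_zero, cosTransform, cosTransform,
      ← integral_sub (integrable_mul_cos hp _) (integrable_mul_cos hn _)]
    refine Eq.trans ?_ (h0 ((-(2 * Real.pi))⁻¹ • t))
    rw [cosTransform]
    congr 1 with x
    rw [← sub_mul]
    congr 1
    rcases le_total 0 (g x) with h | h <;> simp [h]
  rw [withDensity_eq_iff hmp.ennreal_ofReal.aemeasurable hmn.ennreal_ofReal.aemeasurable hfp]
    at heq
  filter_upwards [heq] with x hx
  rw [ENNReal.ofReal_eq_ofReal_iff (le_max_right _ _) (le_max_right _ _)] at hx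
  rcases le_total 0 (g x) with h | h <;> simp [h] at hx <;> simpa using hx

theorem cosTransform_cos [IsFiniteMeasure μ] (η ξ : EuclideanSpace ℝ (Fin d)) :
    cosTransform μ (fun x => Real.cos (2 * Real.pi * ⟪x, η⟫)) ξ =
      (cosTransform μ (fun _ => 1) (ξ + η) + cosTransform μ (fun _ => 1) (ξ - η)) / 2 := by
  simp only [cosTransform]
  rw [← integral_add (integrable_mul_cos (integrable_const 1) _)
    (integrable_mul_cos (integrable_const 1) _), ← integral_div]
  congr 1 with x
  rw [inner_add_right, inner_sub_right, mul_add, mul_sub, Real.cos_add, Real.cos_sub]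
  ring

/-- Multiplying by a cosine averages two translates of the transform, and `‖ξ‖ ^ β` is at most `2 ^
β` times the sum of the weight at the translate and at `η`. Thus cosines are legitimate test
functions. -/
theorem abs_cosTransform_cos_mul_le [IsFiniteMeasure μ] {β M : ℝ} (hβ : 0 < β)
    (hM : ∀ ξ, |cosTransform μ (fun _ => 1) ξ| * ‖ξ‖ ^ β ≤ M) (η ξ : EuclideanSpace ℝ (Fin d)) :
    |cosTransform μ (fun x => Real.cos (2 * Real.pi * ⟪x, η⟫)) ξ * ‖ξ‖ ^ β| ≤
      2 ^ β * (M + μ.real Set.univ * ‖η‖ ^ β) := by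
  have hV : ∀ ξ, |cosTransform μ (fun _ => 1) ξ| ≤ μ.real Set.univ := fun ξ => by
    simpa using abs_cosTransform_le (μ := μ) (f := fun _ => 1) (integrable_const 1) ξ
  have key : ∀ ζ : EuclideanSpace ℝ (Fin d), ‖ξ‖ ≤ ‖ζ‖ + ‖η‖ →
      |cosTransform μ (fun _ => 1) ζ| * ‖ξ‖ ^ β ≤ 2 ^ β * (M + μ.real Set.univ * ‖η‖ ^ β) := by
    intro ζ hζ
    have h1 : ‖ξ‖ ^ β ≤ 2 ^ β * (‖ζ‖ ^ β + ‖η‖ ^ β) := by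
      have h2 : ‖ξ‖ ≤ 2 * max ‖ζ‖ ‖η‖ := by
        have := le_max_left ‖ζ‖ ‖η‖
        have := le_max_right ‖ζ‖ ‖η‖
        linarith
      refine (Real.rpow_le_rpow (norm_nonneg _) h2 hβ.le).trans ?_
      rw [Real.mul_rpow zero_le_two (by positivity)]
      gcongr
      rcases max_choice ‖ζ‖ ‖η‖ with h | h <;> rw [h]
      · exact le_add_of_nonneg_right (by positivity)
      · exact le_add_of_nonneg_left (by positivity)
    calc |cosTransform μ (fun _ => 1) ζ| * ‖ξ‖ ^ β
        ≤ |cosTransform μ (fun _ => 1) ζ| * (2 ^ β * (‖ζ‖ ^ β + ‖η‖ ^ β)) := by gcongr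
      _ = 2 ^ β * (|cosTransform μ (fun _ => 1) ζ| * ‖ζ‖ ^ β +
          |cosTransform μ (fun _ => 1) ζ| * ‖η‖ ^ β) := by ring
      _ ≤ _ := by gcongr; exacts [hM ζ, hV ζ]
  have h1 := key (ξ + η) (by simpa using norm_sub_le (ξ + η) η)
  have h2 := key (ξ - η) (by simpa using norm_add_le (ξ - η) η)
  rw [cosTransform_cos, abs_mul, abs_of_nonneg (Real.rpow_nonneg (norm_nonneg ξ) β), abs_div,
    abs_two]
  have h3 := mul_le_mul_of_nonneg_right (abs_add_le (cosTransform μ (fun _ => 1) (ξ + η))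
    (cosTransform μ (fun _ => 1) (ξ - η))) (Real.rpow_nonneg (norm_nonneg ξ) β)
  linarith

/-- Even bounded continuous functions whose weighted cosine transform is bounded. -/
def admissible (μ : Measure (EuclideanSpace ℝ (Fin d))) [IsFiniteMeasure μ] (β : ℝ) :
    Submodule ℝ (EuclideanSpace ℝ (Fin d) → ℝ) where
  carrier := {f | Continuous f ∧ (∀ x, f (-x) = f x) ∧ (∃ B, ∀ x, |f x| ≤ B) ∧
    ∃ C, ∀ ξ, |cosTransform μ f ξ * ‖ξ‖ ^ β| ≤ C}
  add_mem' := by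
    rintro f g ⟨hf, hfe, ⟨B, hB⟩, ⟨C, hC⟩⟩ ⟨hg, hge, ⟨B', hB'⟩, ⟨C', hC'⟩⟩
    have hfi : Integrable f μ :=
      (integrable_const B).mono' hf.aestronglyMeasurable (.of_forall hB)
    have hgi : Integrable g μ :=
      (integrable_const B').mono' hg.aestronglyMeasurable (.of_forall hB')
    refine ⟨hf.add hg, fun x => by simp [hfe, hge],
      ⟨B + B', fun x => (abs_add_le _ _).trans (add_le_add (hB x) (hB' x))⟩,
      ⟨C + C', fun ξ => ?_⟩⟩
    have := cosTransform_add hfi hgi ξ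
    rw [show f + g = fun x => f x + g x from rfl, this, add_mul]
    exact (abs_add_le _ _).trans (add_le_add (hC ξ) (hC' ξ))
  zero_mem' := ⟨continuous_const, by simp, ⟨0, by simp⟩, ⟨0, by simp [cosTransform]⟩⟩
  smul_mem' := by
    rintro c f ⟨hf, hfe, ⟨B, hB⟩, ⟨C, hC⟩⟩
    refine ⟨hf.const_smul c, fun x => by simp [hfe], ⟨|c| * B, fun x => ?_⟩,
      ⟨|c| * C, fun ξ => ?_⟩⟩
    · rw [Pi.smul_apply, smul_eq_mul, abs_mul]
      exact mul_le_mul_of_nonneg_left (hB x) (abs_nonneg c)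
    · rw [show c • f = fun x => c * f x from rfl, cosTransform_const_mul, mul_assoc, abs_mul]
      exact mul_le_mul_of_nonneg_left (hC ξ) (abs_nonneg c)

theorem integrable_of_mem_admissible [IsFiniteMeasure μ] {β : ℝ}
    {f : EuclideanSpace ℝ (Fin d) → ℝ} (h : f ∈ admissible μ β) : Integrable f μ := by
  obtain ⟨hf, -, ⟨B, hB⟩, -⟩ := h
  exact (integrable_const B).mono' hf.aestronglyMeasurable (.of_forall hB)

theorem integrable_mul_of_mem_admissible [IsFiniteMeasure μ] {β : ℝ}
    {f g : EuclideanSpace ℝ (Fin d) → ℝ} (h : f ∈ admissible μ β) (hg : Integrable g μ) :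
    Integrable (fun x => f x * g x) μ := by
  obtain ⟨hf, -, ⟨B, hB⟩, -⟩ := h
  exact hg.bdd_mul (c := B) hf.aestronglyMeasurable (.of_forall hB)

/-- The restriction to `K` of the weighted character `ξ ↦ w(ξ) cos(2π⟨x, ξ⟩)`. -/
def cosMap {K : Set (EuclideanSpace ℝ (Fin d))} (w : C(K, ℝ)) (x : EuclideanSpace ℝ (Fin d)) :
    C(K, ℝ) :=
  ⟨fun ξ => w ξ * Real.cos (2 * Real.pi * ⟪x, (ξ : EuclideanSpace ℝ (Fin d))⟫), by fun_prop⟩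

theorem continuous_cosMap {K : Set (EuclideanSpace ℝ (Fin d))} (w : C(K, ℝ)) :
    Continuous (cosMap w) := by
  have h : Continuous fun p : EuclideanSpace ℝ (Fin d) × K =>
      w p.2 * Real.cos (2 * Real.pi * ⟪p.1, (p.2 : EuclideanSpace ℝ (Fin d))⟫) := by fun_prop
  exact (ContinuousMap.curry ⟨_, h⟩).continuous

theorem norm_cosMap_le {K : Set (EuclideanSpace ℝ (Fin d))} [CompactSpace K] (w : C(K, ℝ))
    (x : EuclideanSpace ℝ (Fin d)) : ‖cosMap w x‖ ≤ ‖w‖ := by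
  refine (ContinuousMap.norm_le _ (norm_nonneg w)).2 fun ξ => ?_
  simp only [cosMap, ContinuousMap.coe_mk, norm_mul]
  exact (mul_le_of_le_one_right (norm_nonneg _) (Real.abs_cos_le_one _)).trans
    (w.norm_coe_le_norm ξ)

/-- The weighted transform on `K` is a Bochner integral of `C(K, ℝ)`-valued functions, through which
`Λ` passes. No representing measure for `Λ` is needed. -/
theorem clm_cosTransform {K : Set (EuclideanSpace ℝ (Fin d))} [CompactSpace K] (w : C(K, ℝ))
    (Λ : C(K, ℝ) →L[ℝ] ℝ) {f : EuclideanSpace ℝ (Fin d) → ℝ} (hf : Integrable f μ)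
    (F : C(K, ℝ)) (hF : ∀ ξ : K, F ξ = cosTransform μ f ξ * w ξ) :
    Integrable (fun x => f x * Λ (cosMap w x)) μ ∧
      Λ F = ∫ x, f x * Λ (cosMap w x) ∂μ := by
  have hint : Integrable (fun x => f x • cosMap w x) μ :=
    hf.smul_bdd ‖w‖ (continuous_cosMap w).aestronglyMeasurable
      (.of_forall (norm_cosMap_le w))
  have hFeq : F = ∫ x, f x • cosMap w x ∂μ := by
    ext ξ
    rw [ContinuousMap.integral_apply hint, hF, cosTransform, ← integral_mul_const]
    congr 1 with x
    simp [cosMap]; ring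
  constructor
  · simpa using Λ.integrable_comp hint
  · rw [hFeq, ← Λ.integral_comp_comm hint]
    simp

/-- The Euler–Lagrange equation of the uncertainty functional. -/
theorem IsRadial.exists_multiplier [IsFiniteMeasure μ] {α β : ℝ} (hα : 0 < α) (hβ : 0 < β)
    (hrad : IsRadial μ) (hμ : μ ≠ 0) {M : ℝ} (hM : 0 < M)
    (hMμ : M = (weightedSupNorm β μ).toReal)
    (hfin : weightedSupNorm β μ ≠ ∞) (hint : Integrable (fun x => ‖x‖ ^ α) μ)
    (hmpos : 0 < ∫ x, ‖x‖ ^ α ∂μ)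
    (hext : uncertaintyQuotient α β μ = optimalConstant α β d)
    (hK : IsCompact {ξ | M / 2 ≤ |cosTransform μ (fun _ => 1) ξ * ‖ξ‖ ^ β|}) :
    ∃ (K : Set (EuclideanSpace ℝ (Fin d))) (_ : CompactSpace K) (w : C(K, ℝ))
      (Λ : C(K, ℝ) →L[ℝ] ℝ) (a b : ℝ), b ≠ 0 ∧
      ∀ᵐ x ∂μ, Λ (cosMap w x) + b * ‖x‖ ^ α - a = 0 := by
  set K := {ξ | M / 2 ≤ |cosTransform μ (fun _ => 1) ξ * ‖ξ‖ ^ β|} with hKdef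
  have hKc : CompactSpace K := isCompact_iff_compactSpace.1 hK
  set V := μ.real Set.univ with hVdef
  set m := ∫ x, ‖x‖ ^ α ∂μ with hmdef
  have hV : 0 < V := by
    rw [hVdef, measureReal_def]; exact ENNReal.toReal_pos (by simpa using hμ) (by simp)
  have hw : Continuous fun ξ : EuclideanSpace ℝ (Fin d) => ‖ξ‖ ^ β :=
    continuous_norm.rpow_const fun _ => Or.inr hβ.le
  have hMle : ∀ ξ, |cosTransform μ (fun _ => 1) ξ| * ‖ξ‖ ^ β ≤ M := fun ξ => by
    have := norm_measureFourier_mul_le hβ hfin ξ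
    rwa [hrad.measureFourier_eq, Complex.norm_real, Real.norm_eq_abs, ← hMμ] at this
  let w : C(K, ℝ) := ⟨fun ξ => ‖(ξ : EuclideanSpace ℝ (Fin d))‖ ^ β,
    hw.comp continuous_subtype_val⟩
  have hadm : ∀ f : admissible μ β, Integrable f.1 μ := fun f => integrable_of_mem_admissible f.2
  let T : admissible μ β →ₗ[ℝ] C(K, ℝ) :=
    { toFun := fun f => ⟨fun ξ => cosTransform μ f.1 ξ * ‖(ξ : EuclideanSpace ℝ (Fin d))‖ ^ β,
        ((continuous_cosTransform (hadm f)).mul hw).comp continuous_subtype_val⟩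
      map_add' := fun f g => by
        ext ξ
        change cosTransform μ (fun x => f.1 x + g.1 x) ξ * _ = _ * _ + _ * _
        rw [cosTransform_add (hadm f) (hadm g), add_mul]
      map_smul' := fun c f => by
        ext ξ
        change cosTransform μ (fun x => c * f.1 x) ξ * _ = c * (_ * _)
        rw [cosTransform_const_mul, mul_assoc] }
  have hmadm : ∀ f : admissible μ β, Integrable (fun x => f.1 x * ‖x‖ ^ α) μ :=
    fun f => integrable_mul_of_mem_admissible f.2 hint
  let L : admissible μ β →ₗ[ℝ] ℝ :=
    { toFun := fun f => β * (∫ x, f.1 x * ‖x‖ ^ α ∂μ) / m - (α + β) * (∫ x, f.1 x ∂μ) / V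
      map_add' := fun f g => by
        have h1 : ∫ x, (f + g).1 x * ‖x‖ ^ α ∂μ =
            ∫ x, f.1 x * ‖x‖ ^ α ∂μ + ∫ x, g.1 x * ‖x‖ ^ α ∂μ := by
          rw [← integral_add (hmadm f) (hmadm g)]
          congr 1 with x
          exact add_mul _ _ _
        have h2 : ∫ x, (f + g).1 x ∂μ = ∫ x, f.1 x ∂μ + ∫ x, g.1 x ∂μ :=
          integral_add (hadm f) (hadm g)
        rw [h1, h2]; ring
      map_smul' := fun c f => by
        have h1 : ∫ x, (c • f).1 x * ‖x‖ ^ α ∂μ = c * ∫ x, f.1 x * ‖x‖ ^ α ∂μ := by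
          rw [← integral_const_mul]
          congr 1 with x
          exact mul_assoc _ _ _
        have h2 : ∫ x, (c • f).1 x ∂μ = c * ∫ x, f.1 x ∂μ := integral_const_mul _ _
        rw [h1, h2, RingHom.id_apply, smul_eq_mul]; ring }
  have hcos : ∀ η : EuclideanSpace ℝ (Fin d),
      (fun x => Real.cos (2 * Real.pi * ⟪x, η⟫)) ∈ admissible μ β := fun η =>
    ⟨by fun_prop, fun x => by simp [inner_neg_left], ⟨1, fun x => Real.abs_cos_le_one _⟩,
      ⟨_, abs_cosTransform_cos_mul_le hβ hMle η⟩⟩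
  have hone : (fun _ => 1) ∈ admissible μ β := by simpa using hcos 0
  let e : admissible μ β := ⟨fun _ => 1, hone⟩
  -- The constant function `e` represents `μ` itself, so `T e` is the weighted transform on `K` and
  -- `T e + T f` its perturbation.
  obtain ⟨Λ, hΛpos, hΛ⟩ := exists_clm_pos_of_le_norm T L (T e) hM (fun f hf => by
    obtain ⟨hf1, hf2, ⟨B, hB⟩, ⟨C, hC⟩⟩ := f.2
    obtain ⟨ξ, hξ, hle⟩ := hrad.exists_le_perturbation hα hβ hμ hM hMμ hfin hint hmpos hext hK
      hf1 hf2 hB hC (sub_eq_zero.1 hf)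
    exact hle.trans ((T e + T f).norm_coe_le_norm ⟨ξ, hξ⟩))
  have hLe : L e = -α := by
    change β * (∫ x, (1 : ℝ) * ‖x‖ ^ α ∂μ) / m - (α + β) * (∫ x, (1 : ℝ) ∂μ) / V = -α
    have h2 : ∫ x, (1 : ℝ) ∂μ = V := by simp [hVdef]
    simp only [one_mul, h2]
    rw [← hmdef]
    field_simp
    ring
  -- Since `L e = -α ≠ 0`, any `f` is corrected into the kernel of `L` by adding a multiple of `e`.
  have hEL : ∀ f, Λ (T f) + L f / α * Λ (T e) = 0 := fun f => by
    have h := hΛ (f + (L f / α) • e) (by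
      rw [map_add, map_smul, hLe, smul_eq_mul]; field_simp; ring)
    simpa using h
  set c := Λ (T e) with hc
  refine ⟨K, hKc, w, Λ, c / α * ((α + β) / V), c / α * (β / m), by positivity, ?_⟩
  set g : EuclideanSpace ℝ (Fin d) → ℝ := fun x =>
    Λ (cosMap w x) + c / α * (β / m) * ‖x‖ ^ α - c / α * ((α + β) / V) with hg
  have hGint : Integrable (fun x => Λ (cosMap w x)) μ := by
    simpa [e] using (clm_cosTransform w Λ (hadm e) (T e) fun ξ => rfl).1
  have hgint : Integrable g μ := (hGint.add (hint.const_mul _)).sub (integrable_const _)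
  have hgc : Continuous g := by
    have h1 := Λ.continuous.comp (continuous_cosMap w)
    have h2 : Continuous fun x : EuclideanSpace ℝ (Fin d) => ‖x‖ ^ α :=
      continuous_norm.rpow_const fun _ => Or.inr hα.le
    exact (h1.add (h2.const_mul _)).sub continuous_const
  refine hrad.ae_eq_zero_of_cosTransform_eq_zero hgint hgc.measurable (fun x => ?_) fun η => ?_
  · have : cosMap w (-x) = cosMap w x := by ext ξ; simp [cosMap]
    simp [this]
  -- The relation `hEL` says that `g` is orthogonal to every test function; applied to cosines, its
  -- cosine transform vanishes.
  · let f : admissible μ β := ⟨_, hcos η⟩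
    obtain ⟨h1, h2⟩ := clm_cosTransform w Λ (hadm f) (T f) fun ξ => rfl
    have h3 := hEL f
    rw [h2] at h3
    have h4 : cosTransform μ g η = ∫ x, f.1 x * Λ (cosMap w x) ∂μ +
        (c / α * (β / m)) * ∫ x, f.1 x * ‖x‖ ^ α ∂μ -
          (c / α * ((α + β) / V)) * ∫ x, f.1 x ∂μ := by
      have h12 : Integrable (fun x => f.1 x * Λ (cosMap w x) +
          (c / α * (β / m)) * (f.1 x * ‖x‖ ^ α)) μ := h1.add ((hmadm f).const_mul _)
      rw [← integral_const_mul, ← integral_const_mul, ← integral_add h1 ((hmadm f).const_mul _),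
        ← integral_sub h12 ((hadm f).const_mul _), cosTransform]
      congr 1 with x
      simp only [hg, f]
      ring
    rw [h4, ← h3]
    change _ = _ + (β * (∫ x, f.1 x * ‖x‖ ^ α ∂μ) / m - (α + β) * (∫ x, f.1 x ∂μ) / V) / α * c
    ring

/-! ### Analyticity along rays and finiteness of the radii -/

/-- The cosine is the real part of `exp (r • A)` in the Banach algebra `C(K, ℂ)`, where the
exponential is analytic; the rest is a continuous linear map. -/
theorem analyticOnNhd_clm_cosMap {K : Set (EuclideanSpace ℝ (Fin d))} [CompactSpace K]
    (w : C(K, ℝ)) (Λ : C(K, ℝ) →L[ℝ] ℝ) (e : EuclideanSpace ℝ (Fin d)) :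
    AnalyticOnNhd ℝ (fun r : ℝ => Λ (cosMap w (r • e))) Set.univ := by
  let A : C(K, ℂ) := ⟨fun ξ =>
    ((2 * Real.pi * ⟪e, (ξ : EuclideanSpace ℝ (Fin d))⟫ : ℝ) : ℂ) * Complex.I, by fun_prop⟩
  let Re : C(K, ℂ) →L[ℝ] C(K, ℝ) := Complex.reCLM.compLeftContinuous ℝ K
  have hfun : (fun r : ℝ => Λ (cosMap w (r • e))) =
      fun r : ℝ => (Λ ∘L (ContinuousLinearMap.mul ℝ C(K, ℝ) w) ∘L Re)
        (NormedSpace.exp (r • A)) := by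
    ext r
    simp only [ContinuousLinearMap.comp_apply]
    congr 1
    ext ξ
    have h1 : (NormedSpace.exp (r • A)) ξ = Complex.exp ((r • A) ξ) := by
      rw [Complex.exp_eq_exp_ℂ]
      exact NormedSpace.map_exp (ContinuousMap.evalAlgHom ℂ ℂ ξ)
        (continuous_eval_const ξ) (r • A)
    have h2 : (r • A) ξ =
        ((r * (2 * Real.pi * ⟪e, (ξ : EuclideanSpace ℝ (Fin d))⟫) : ℝ) : ℂ) * Complex.I := by
      simp [A]; ring
    have h3 : (Re (NormedSpace.exp (r • A))) ξ = ((NormedSpace.exp (r • A)) ξ).re := rfl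
    simp only [cosMap, ContinuousMap.coe_mk, ContinuousLinearMap.mul_apply',
      ContinuousMap.mul_apply]
    rw [h3, h1, h2, Complex.exp_ofReal_mul_I_re, real_inner_smul_left]
    ring_nf
  rw [hfun]
  intro r _
  have h : AnalyticAt ℝ (fun r : ℝ => NormedSpace.exp (r • A)) r :=
    (NormedSpace.exp_analytic (𝕂 := ℝ) (r • A)).comp_of_eq
      (analyticAt_id.smul analyticAt_const) rfl
  exact (ContinuousLinearMap.analyticAt _ _).comp h

/-- Boundedness of `P` confines the zeros to a bounded interval, so infinitely many would
accumulate. At a positive point the identity theorem applies; at `0`, where `r ^ α` need not be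
analytic, compare `α` with the vanishing order of `P`. -/
theorem finite_zeros_add_rpow {P : ℝ → ℝ} (hP : AnalyticOnNhd ℝ P Set.univ) {C α b : ℝ}
    (hC : ∀ r, |P r| ≤ C) (hα : 0 < α) (hb : b ≠ 0) :
    {r : ℝ | 0 < r ∧ P r + b * r ^ α = 0}.Finite := by
  set S := {r : ℝ | 0 < r ∧ P r + b * r ^ α = 0} with hS
  obtain ⟨R, hR0, hR⟩ : ∃ R : ℝ, 0 < R ∧ ∀ r, R ≤ r → P r + b * r ^ α ≠ 0 := by
    have h1 : Tendsto (fun r : ℝ => |b| * r ^ α) atTop atTop :=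
      (tendsto_rpow_atTop hα).const_mul_atTop (abs_pos.2 hb)
    obtain ⟨R, hR⟩ := ((h1.eventually_gt_atTop C).and (eventually_gt_atTop 0)).exists_forall_of_atTop
    refine ⟨R, (hR R le_rfl).2, fun r hr h0 => ?_⟩
    obtain ⟨h2, h3⟩ := hR r hr
    have h4 : |P r| = |b| * r ^ α := by
      rw [eq_neg_of_add_eq_zero_left h0, abs_neg, abs_mul, abs_of_pos (Real.rpow_pos_of_pos h3 α)]
    linarith [hC r]
  by_contra hinf
  have hsub : S ⊆ Set.Icc 0 R := fun r hr =>
    ⟨hr.1.le, le_of_not_gt fun h => hR r h.le hr.2⟩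
  obtain ⟨z, hz, hacc⟩ := Set.Infinite.exists_accPt_of_subset_isCompact hinf isCompact_Icc hsub
  rw [accPt_iff_frequently_nhdsNE] at hacc
  rcases hz.1.eq_or_lt with rfl | hz0
  · have hfr : ∃ᶠ r in nhdsWithin (0 : ℝ) (Set.Ioi 0), r ∈ S := by
      rw [frequently_nhdsWithin_iff] at hacc ⊢
      exact hacc.mono fun r hr => ⟨hr.1, hr.1.1⟩
    by_cases hev : ∀ᶠ r in nhds (0 : ℝ), P r = 0
    · obtain ⟨r, hr, hr0⟩ := (hfr.and_eventually (hev.filter_mono nhdsWithin_le_nhds)).exists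
      have := hr.2
      rw [hr0, zero_add] at this
      exact mul_ne_zero hb (Real.rpow_pos_of_pos hr.1 α).ne' this
    · obtain ⟨n, g, hg, hg0, hPg⟩ :=
        (hP 0 trivial).exists_eventuallyEq_pow_smul_nonzero_iff.2 hev
      have hgt : Tendsto g (nhdsWithin (0 : ℝ) (Set.Ioi 0)) (nhds (g 0)) :=
        hg.continuousAt.tendsto.mono_left nhdsWithin_le_nhds
      have hPg' : ∃ᶠ r in nhdsWithin (0 : ℝ) (Set.Ioi 0), 0 < r ∧ r ^ n * g r + b * r ^ α = 0 :=
        (hfr.and_eventually (hPg.filter_mono nhdsWithin_le_nhds)).mono fun r hr =>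
          ⟨hr.1.1, by simpa [hr.2] using hr.1.2⟩
      have hpow : ∀ s : ℝ, 0 < s →
          Tendsto (fun r : ℝ => r ^ s) (nhdsWithin (0 : ℝ) (Set.Ioi 0)) (nhds 0) := fun s hs => by
        have := (Real.continuousAt_rpow_const 0 s (Or.inr hs.le)).tendsto
        rw [Real.zero_rpow hs.ne'] at this
        exact this.mono_left nhdsWithin_le_nhds
      -- If `α ≠ n`, dividing by the smaller power leaves a nonzero limit, `b` or `g 0`. If `α = n`,
      -- the sum extends to an analytic function on the whole line and the identity theorem applies
      -- again.
      rcases lt_trichotomy α n with h | h | h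
      · have ht : Tendsto (fun r : ℝ => r ^ ((n : ℝ) - α) * g r + b)
            (nhdsWithin (0 : ℝ) (Set.Ioi 0)) (nhds (0 * g 0 + b)) :=
          ((hpow _ (sub_pos.2 h)).mul hgt).add_const b
        obtain ⟨r, ⟨hr0, hr⟩, hne⟩ := (hPg'.and_eventually (ht.eventually_ne (by simpa))).exists
        apply hne
        rw [Real.rpow_sub hr0, Real.rpow_natCast]
        have := (Real.rpow_pos_of_pos hr0 α).ne'
        field_simp
        linarith
      · have han : AnalyticOnNhd ℝ (fun r => P r + b * r ^ n) Set.univ := fun r hr =>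
          (hP r hr).add (analyticAt_const.mul (analyticAt_id.pow n))
        have hfz : ∃ᶠ r in nhdsWithin (0 : ℝ) {0}ᶜ, P r + b * r ^ n = (fun _ => 0) r :=
          hacc.mono fun r hr => by
            have := hr.2
            rwa [h, Real.rpow_natCast] at this
        have heq := han.eq_of_frequently_eq (fun r _ => analyticAt_const) hfz
        apply hR R le_rfl
        rw [h, Real.rpow_natCast]
        exact congrFun heq R
      · have ht : Tendsto (fun r : ℝ => g r + b * r ^ (α - n))
            (nhdsWithin (0 : ℝ) (Set.Ioi 0)) (nhds (g 0 + b * 0)) :=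
          hgt.add ((hpow _ (sub_pos.2 h)).const_mul b)
        obtain ⟨r, ⟨hr0, hr⟩, hne⟩ := (hPg'.and_eventually (ht.eventually_ne (by simpa))).exists
        apply hne
        rw [Real.rpow_sub hr0, Real.rpow_natCast]
        have := (pow_pos hr0 n).ne'
        field_simp
        linarith
  · have han : AnalyticOnNhd ℝ (fun r => P r + b * r ^ α) (Set.Ioi 0) := fun r hr =>
      (hP r trivial).add (analyticAt_const.mul 
        (Real.contDiffAt_rpow_const_of_ne (ne_of_gt hr)).analyticAt)
    exact hR R le_rfl (han.eqOn_zero_of_preconnected_of_frequently_eq_zero isPreconnected_Ioi hz0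
      (hacc.mono fun r hr => hr.2) hR0)

/-- A radial measure carried by the zero set of a continuous function is carried by the spheres
whose radii are zeros of the function along a fixed ray. -/
theorem IsRadial.ae_eq_zero_on_ray (hrad : IsRadial μ) {g : EuclideanSpace ℝ (Fin d) → ℝ}
    (hg : Continuous g) (h0 : ∀ᵐ x ∂μ, g x = 0) {e : EuclideanSpace ℝ (Fin d)} (he : ‖e‖ = 1) :
    ∀ᵐ x ∂μ, g (‖x‖ • e) = 0 := by
  refine measure_null_of_locally_null _ fun x hx => ?_
  have hn : ‖x‖ = ‖‖x‖ • e‖ := by rw [norm_smul, he, norm_norm, mul_one]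
  -- This reflection carries `x` to the ray and preserves `μ`, so the neighbourhood of `x` on which
  -- `g ∘ R` is nonzero is null.
  let R := (Submodule.span ℝ {x - ‖x‖ • e})ᗮ.reflection
  have hR : R x = ‖x‖ • e := Submodule.reflection_sub hn
  refine ⟨{y | g (R y) ≠ 0}, mem_nhdsWithin_of_mem_nhds ?_, ?_⟩
  · exact (hg.comp R.continuous).continuousAt.eventually_ne (by simpa [hR] using hx)
  · exact (hrad.measurePreserving R).quasiMeasurePreserving.ae h0

/-! ### Bessel's equation and its asymptotics -/

/-- Carrying a phase `φ` keeps the derivative in the same shape, with `φ` shifted by `π / 2`, so the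
lemma can be iterated. -/
theorem hasDerivAt_integral_cos [IsFiniteMeasure μ] {p : EuclideanSpace ℝ (Fin d) → ℝ}
    (hp : Continuous p) {B r : ℝ} (hB : ∀ᵐ x ∂μ, |p x| ≤ B) (hr : ∀ᵐ x ∂μ, ‖x‖ ≤ r)
    (φ : ℝ) (a b : EuclideanSpace ℝ (Fin d)) (t : ℝ) :
    HasDerivAt (fun t : ℝ => ∫ x, p x * Real.cos (2 * Real.pi * ⟪x, a + t • b⟫ + φ) ∂μ)
      (∫ x, (p x * (2 * Real.pi * ⟪x, b⟫)) *
        Real.cos (2 * Real.pi * ⟪x, a + t • b⟫ + (φ + Real.pi / 2)) ∂μ) t := by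
  refine (hasDerivAt_integral_of_dominated_loc_of_deriv_le
    (bound := fun _ => B * (2 * Real.pi * (r * ‖b‖))) (s := Set.univ)
    (F' := fun t x => (p x * (2 * Real.pi * ⟪x, b⟫)) *
        Real.cos (2 * Real.pi * ⟪x, a + t • b⟫ + (φ + Real.pi / 2)))
    Filter.univ_mem (.of_forall fun t => ?_) ?_ ?_ ?_ (integrable_const _) ?_).2
  · exact (by fun_prop : Continuous _).aestronglyMeasurable
  · refine (integrable_const B).mono' (by fun_prop : Continuous _).aestronglyMeasurable ?_
    filter_upwards [hB] with x hx
    rw [norm_mul]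
    exact (mul_le_of_le_one_right (norm_nonneg _) (Real.abs_cos_le_one _)).trans hx
  · exact (by fun_prop : Continuous _).aestronglyMeasurable
  · filter_upwards [hB, hr] with x hx hxr t _
    rw [norm_mul]
    refine (mul_le_of_le_one_right (norm_nonneg _) (Real.abs_cos_le_one _)).trans ?_
    have h1 : |⟪x, b⟫| ≤ r * ‖b‖ := (abs_real_inner_le_norm x b).trans (by gcongr)
    rw [Real.norm_eq_abs, abs_mul, abs_mul, abs_of_pos Real.two_pi_pos]
    have : 0 ≤ B := (abs_nonneg _).trans hx
    have := Real.pi_pos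
    gcongr
  · refine .of_forall fun x t _ => ?_
    have h1 : HasDerivAt (fun t : ℝ => 2 * Real.pi * ⟪x, a + t • b⟫ + φ)
        (2 * Real.pi * ⟪x, b⟫) t := by
      simp only [inner_add_right, real_inner_smul_right]
      simpa using ((((hasDerivAt_id t).mul_const ⟪x, b⟫).const_add ⟪x, a⟫).const_mul
        (2 * Real.pi)).add_const φ
    refine (h1.cos.const_mul (p x)).congr_deriv ?_
    rw [← add_assoc, Real.cos_add_pi_div_two]
    ring

theorem IsRadial.cosTransform_one_eq_of_norm_eq (hrad : IsRadial μ)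
    {ξ η : EuclideanSpace ℝ (Fin d)} (h : ‖ξ‖ = ‖η‖) :
    cosTransform μ (fun _ => 1) ξ = cosTransform μ (fun _ => 1) η := by
  let R := (Submodule.span ℝ {ξ - η})ᗮ.reflection
  have hR : R ξ = η := Submodule.reflection_sub h
  have h1 := hrad.integral_comp R (fun x => (1 : ℝ) * Real.cos (2 * Real.pi * ⟪x, η⟫))
  rw [cosTransform, cosTransform, ← h1, ← hR]
  simp only [R.inner_map_map]

/-- The Fourier transform of a radial measure on a sphere solves Bessel's equation. -/
theorem IsRadial.sphere_ode [IsFiniteMeasure μ] (hrad : IsRadial μ) {r : ℝ}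
    (hr : ∀ᵐ x ∂μ, ‖x‖ = r) (i₀ : Fin d) :
    ∃ F' F'' : ℝ → ℝ,
      (∀ ρ, HasDerivAt (fun ρ : ℝ => cosTransform μ (fun _ => 1)
        (ρ • EuclideanSpace.single i₀ (1 : ℝ))) (F' ρ) ρ) ∧
      (∀ ρ, HasDerivAt F' (F'' ρ) ρ) ∧
      ∀ ρ, 0 < ρ → F'' ρ + (d - 1) / ρ * F' ρ = -(2 * Real.pi * r) ^ 2 *
        cosTransform μ (fun _ => 1) (ρ • EuclideanSpace.single i₀ (1 : ℝ)) := by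
  set e : Fin d → EuclideanSpace ℝ (Fin d) := fun i => EuclideanSpace.single i (1 : ℝ) with he
  have hin : ∀ x i, ⟪x, e i⟫ = x i := fun x i => by simp [he, EuclideanSpace.inner_single_right]
  have hnorm : ∀ i, ‖e i‖ = 1 := fun i => by simp [he]
  have hr' : ∀ᵐ x ∂μ, ‖x‖ ≤ r := hr.mono fun x hx => hx.le
  have hB : ∀ b : EuclideanSpace ℝ (Fin d),
      ∀ᵐ x ∂μ, |1 * (2 * Real.pi * ⟪x, b⟫)| ≤ 2 * Real.pi * (r * ‖b‖) := fun b => by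
    filter_upwards [hr'] with x hx
    rw [one_mul, abs_mul, abs_of_pos Real.two_pi_pos]
    have := Real.pi_pos
    have h1 : |⟪x, b⟫| ≤ r * ‖b‖ := (abs_real_inner_le_norm x b).trans (by gcongr)
    gcongr
  have hD1 := fun a b t => hasDerivAt_integral_cos (μ := μ) (p := fun _ => 1) continuous_const
    (B := 1) (by simp) hr' 0 a b t
  have hD2 := fun a b t => hasDerivAt_integral_cos (μ := μ)
    (p := fun x => 1 * (2 * Real.pi * ⟪x, b⟫)) (by fun_prop) (hB b) hr' (0 + Real.pi / 2) a b t
  have hcos : ∀ a b : EuclideanSpace ℝ (Fin d), ∀ t : ℝ,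
      ∫ x, 1 * Real.cos (2 * Real.pi * ⟪x, a + t • b⟫ + 0) ∂μ =
        cosTransform μ (fun _ => 1) (a + t • b) := fun a b t => by simp [cosTransform]
  set F : ℝ → ℝ := fun ρ => cosTransform μ (fun _ => 1) (ρ • e i₀) with hF
  set F' : ℝ → ℝ := fun t => ∫ x, (1 * (2 * Real.pi * ⟪x, e i₀⟫)) *
        Real.cos (2 * Real.pi * ⟪x, 0 + t • e i₀⟫ + (0 + Real.pi / 2)) ∂μ with hF'
  set F'' : ℝ → ℝ := fun t => ∫ x, (1 * (2 * Real.pi * ⟪x, e i₀⟫)) * (2 * Real.pi * ⟪x, e i₀⟫) *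
        Real.cos (2 * Real.pi * ⟪x, 0 + t • e i₀⟫ + (0 + Real.pi / 2 + Real.pi / 2)) ∂μ with hF''
  have h1 : ∀ ρ, HasDerivAt F (F' ρ) ρ := fun ρ => by
    have h := hD1 0 (e i₀) ρ
    simp only [hcos] at h
    have hFeq : F = fun t => cosTransform μ (fun _ => 1) (0 + t • e i₀) := by simp [hF]
    rw [hFeq]
    exact h
  have h2 : ∀ ρ, HasDerivAt F' (F'' ρ) ρ := fun ρ => hD2 0 (e i₀) ρ
  refine ⟨F', F'', h1, h2, fun ρ hρ => ?_⟩
  have hFrad : ∀ ξ, cosTransform μ (fun _ => 1) ξ = F ‖ξ‖ := fun ξ =>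
    hrad.cosTransform_one_eq_of_norm_eq (by rw [norm_smul, hnorm, norm_norm, mul_one])
  set J : Fin d → ℝ := fun i => ∫ x, (2 * Real.pi * x i) ^ 2 *
    Real.cos (2 * Real.pi * ⟪x, ρ • e i₀⟫) ∂μ with hJ
  have hsecond : ∀ i, ∫ x, (1 * (2 * Real.pi * ⟪x, e i⟫)) * (2 * Real.pi * ⟪x, e i⟫) *
      Real.cos (2 * Real.pi * ⟪x, ρ • e i₀⟫ + (0 + Real.pi / 2 + Real.pi / 2)) ∂μ = -J i := by
    intro i
    rw [hJ, ← integral_neg]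
    congr 1 with x
    rw [hin, zero_add, add_halves, Real.cos_add_pi]
    ring
  have hi₀ : F'' ρ = -J i₀ := by
    rw [← hsecond i₀, hF'']; simp only [zero_add]
  -- In a direction orthogonal to the ray the function is `F (√(ρ² + t²))`; its second derivative at
  -- `t = 0` is `F' ρ / ρ`. There are `d - 1` such directions.
  have hi : ∀ i, i ≠ i₀ → F' ρ / ρ = -J i := by
    intro i hne
    have hsq : ∀ t : ℝ, ‖ρ • e i₀ + t • e i‖ = Real.sqrt (ρ ^ 2 + t ^ 2) := by
      intro t
      have horth : ⟪ρ • e i₀, t • e i⟫ = 0 := by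
        rw [real_inner_smul_left, real_inner_smul_right, hin]
        simp [he, hne]
      rw [eq_comm, Real.sqrt_eq_iff_mul_self_eq (by positivity) (norm_nonneg _),
        norm_add_mul_self_real, horth]
      simp [norm_smul, hnorm]
      ring
    have hpos : ∀ t : ℝ, 0 < ρ ^ 2 + t ^ 2 := fun t => by positivity
    have hderiv : ∀ t : ℝ, HasDerivAt (fun t => F (Real.sqrt (ρ ^ 2 + t ^ 2)))
        (t * (F' (Real.sqrt (ρ ^ 2 + t ^ 2)) / Real.sqrt (ρ ^ 2 + t ^ 2))) t := by
      intro t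
      have h3 : HasDerivAt (fun t : ℝ => ρ ^ 2 + t ^ 2) (2 * t) t := by
        simpa using (hasDerivAt_pow 2 t).const_add (ρ ^ 2)
      have h4 := h3.sqrt (hpos t).ne'
      refine ((h1 _).comp t h4).congr_deriv ?_
      have := (Real.sqrt_pos.2 (hpos t)).ne'
      field_simp
    have heq : ∀ t : ℝ, t * (F' (Real.sqrt (ρ ^ 2 + t ^ 2)) / Real.sqrt (ρ ^ 2 + t ^ 2)) =
        ∫ x, (1 * (2 * Real.pi * ⟪x, e i⟫)) *
          Real.cos (2 * Real.pi * ⟪x, ρ • e i₀ + t • e i⟫ + (0 + Real.pi / 2)) ∂μ := by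
      intro t
      have h3 := hD1 (ρ • e i₀) (e i) t
      simp only [hcos, hFrad, hsq] at h3
      exact (hderiv t).unique h3
    have h5 := hD2 (ρ • e i₀) (e i) 0
    simp only [← heq] at h5
    rw [zero_smul, add_zero, hsecond] at h5
    refine HasDerivAt.unique (x := 0) ?_ h5
    rw [hasDerivAt_iff_tendsto_slope]
    have hc : ContinuousAt (fun t : ℝ => F' (Real.sqrt (ρ ^ 2 + t ^ 2)) /
        Real.sqrt (ρ ^ 2 + t ^ 2)) 0 := by
      have hF'c : Continuous F' := continuous_iff_continuousAt.2 fun x => (h2 x).continuousAt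
      refine ContinuousAt.div (by fun_prop) (by fun_prop) (Real.sqrt_pos.2 (hpos 0)).ne'
    have h6 := hc.tendsto.mono_left (nhdsWithin_le_nhds (s := {0}ᶜ))
    simp only [ne_eq, OfNat.ofNat_ne_zero, not_false_eq_true, zero_pow, add_zero,
      Real.sqrt_sq hρ.le] at h6
    refine h6.congr' ?_
    filter_upwards [self_mem_nhdsWithin] with t ht
    have ht : t ≠ 0 := ht
    rw [slope_def_field]
    field_simp
    simp
    ring
  -- This is where the sphere enters: the squares of the coordinates sum to `r ^ 2` almost
  -- everywhere.
  have hsum : ∑ i, J i = (2 * Real.pi * r) ^ 2 * F ρ := by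
    simp only [hJ]
    rw [← integral_finsetSum]
    · simp only [hF, cosTransform]
      rw [← integral_const_mul]
      refine integral_congr_ae ?_
      filter_upwards [hr] with x hx
      rw [← Finset.sum_mul, one_mul]
      congr 1
      simp only [mul_pow]
      rw [← Finset.mul_sum, ← hx, EuclideanSpace.real_norm_sq_eq]
    · intro i _
      refine (integrable_const ((2 * Real.pi * r) ^ 2)).mono'
        (by fun_prop : Continuous _).aestronglyMeasurable ?_
      filter_upwards [hr] with x hx
      rw [norm_mul]
      refine (mul_le_of_le_one_right (norm_nonneg _) (Real.abs_cos_le_one _)).trans ?_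
      rw [Real.norm_of_nonneg (sq_nonneg _), sq_le_sq]
      simp only [abs_mul]
      have h3 : |x i| ≤ |r| := by
        rw [← hx, abs_norm]
        exact PiLp.norm_apply_le x i
      gcongr
  have hsplit : ∑ i, J i = J i₀ + (d - 1) * (-(F' ρ / ρ)) := by
    rw [← Finset.add_sum_erase _ _ (Finset.mem_univ i₀)]
    congr 1
    rw [Finset.sum_congr rfl (g := fun _ => -(F' ρ / ρ)) fun i h => by
      rw [hi i (Finset.ne_of_mem_erase h), neg_neg]]
    have hd : 1 ≤ d := i₀.pos
    simp [Finset.card_erase_of_mem, Nat.cast_sub hd]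
  rw [hi₀, neg_mul, ← hsum, hsplit]
  ring

/-- A curve whose logarithmic derivative is `O(ρ⁻²)` converges, to a nonzero limit unless it
vanishes. -/
theorem exists_tendsto_of_norm_deriv_le {z z' : ℝ → ℂ} {C : ℝ} (hC : 0 ≤ C)
    (hz : ∀ ρ, 0 < ρ → HasDerivAt z (z' ρ) ρ) (hle : ∀ ρ, 0 < ρ → ‖z' ρ‖ ≤ C * ‖z ρ‖ / ρ ^ 2) :
    ∃ W, Tendsto z atTop (nhds W) ∧ (W = 0 → ∀ ρ, 0 < ρ → z ρ = 0) := by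
  have hN : ∀ ρ, 0 < ρ → HasDerivAt (fun ρ => ‖z ρ‖ ^ 2) (2 * ⟪z ρ, z' ρ⟫) ρ := fun ρ hρ =>
    (hz ρ hρ).norm_sq
  have hNle : ∀ ρ, 0 < ρ → |2 * ⟪z ρ, z' ρ⟫| ≤ 2 * C / ρ ^ 2 * ‖z ρ‖ ^ 2 := fun ρ hρ => by
    rw [abs_mul, abs_two]
    have h1 := abs_real_inner_le_norm (z ρ) (z' ρ)
    have h2 := mul_le_mul_of_nonneg_left (hle ρ hρ) (norm_nonneg (z ρ))
    calc 2 * |⟪z ρ, z' ρ⟫| ≤ 2 * (‖z ρ‖ * (C * ‖z ρ‖ / ρ ^ 2)) := by linarith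
      _ = _ := by ring
  -- The factor `exp (a / ρ)` is an integrating factor: `a = 2C` makes the product decreasing, which
  -- bounds `z`, while `a = -2C` makes it increasing, which forces `z = 0` when the limit is zero.
  have hE : ∀ a ρ : ℝ, 0 < ρ → HasDerivAt (fun ρ => ‖z ρ‖ ^ 2 * Real.exp (a * ρ⁻¹))
      (Real.exp (a * ρ⁻¹) * (2 * ⟪z ρ, z' ρ⟫ - a / ρ ^ 2 * ‖z ρ‖ ^ 2)) ρ := fun a ρ hρ => by
    refine ((hN ρ hρ).mul ((hasDerivAt_inv hρ.ne').const_mul a).exp).congr_deriv ?_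
    field_simp
    ring
  have hanti : AntitoneOn (fun ρ => ‖z ρ‖ ^ 2 * Real.exp (2 * C * ρ⁻¹)) (Set.Ioi 0) := by
    refine antitoneOn_of_hasDerivWithinAt_nonpos (convex_Ioi 0)
      (fun ρ hρ => (hE _ ρ hρ).continuousAt.continuousWithinAt)
      (fun ρ hρ => (hE _ ρ (by simpa using hρ)).hasDerivWithinAt) fun ρ hρ => ?_
    have h1 := (abs_le.1 (hNle ρ (by simpa using hρ))).2
    exact mul_nonpos_of_nonneg_of_nonpos (Real.exp_pos _).le (by linarith)
  have hmono : MonotoneOn (fun ρ => ‖z ρ‖ ^ 2 * Real.exp (-(2 * C) * ρ⁻¹)) (Set.Ioi 0) := by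
    refine monotoneOn_of_hasDerivWithinAt_nonneg (convex_Ioi 0)
      (fun ρ hρ => (hE _ ρ hρ).continuousAt.continuousWithinAt)
      (fun ρ hρ => (hE _ ρ (by simpa using hρ)).hasDerivWithinAt) fun ρ hρ => ?_
    have h1 := (abs_le.1 (hNle ρ (by simpa using hρ))).1
    refine mul_nonneg (Real.exp_pos _).le ?_
    rw [neg_div]
    linarith
  set D := Real.sqrt (‖z 1‖ ^ 2 * Real.exp (2 * C * (1 : ℝ)⁻¹)) with hD
  have hbd : ∀ ρ, 1 < ρ → ‖z ρ‖ ≤ D := fun ρ hρ => by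
    refine Real.le_sqrt_of_sq_le ((le_mul_of_one_le_right (sq_nonneg _) ?_).trans
      (hanti (Set.mem_Ioi.2 one_pos) (Set.mem_Ioi.2 (one_pos.trans hρ)) hρ.le))
    have : 0 < ρ := one_pos.trans hρ
    exact Real.one_le_exp (by positivity)
  have hint : IntegrableOn z' (Set.Ioi 1) := by
    have h1 : IntegrableOn (fun ρ : ℝ => C * D * ρ ^ (-2 : ℝ)) (Set.Ioi 1) :=
      (integrableOn_Ioi_rpow_of_lt (by norm_num) one_pos).const_mul _
    refine h1.mono' ?_ ?_
    · refine (stronglyMeasurable_deriv z).aestronglyMeasurable.congr ?_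
      filter_upwards [ae_restrict_mem measurableSet_Ioi] with ρ hρ
      exact (hz ρ (one_pos.trans hρ)).deriv
    · filter_upwards [ae_restrict_mem measurableSet_Ioi] with ρ hρ
      have h0 : 0 < ρ := one_pos.trans hρ
      refine (hle ρ h0).trans ?_
      rw [Real.rpow_neg h0.le, Real.rpow_two, div_eq_mul_inv]
      have := hbd ρ hρ
      gcongr
  have hlim := tendsto_limUnder_of_hasDerivAt_of_integrableOn_Ioi
    (fun ρ hρ => hz ρ (one_pos.trans hρ)) hint
  refine ⟨_, hlim, fun hW ρ hρ => ?_⟩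
  rw [hW] at hlim
  have h1 : Tendsto (fun ρ : ℝ => ‖z ρ‖ ^ 2 * Real.exp (-(2 * C) * ρ⁻¹)) atTop
      (nhds (‖(0 : ℂ)‖ ^ 2 * Real.exp (-(2 * C) * 0))) :=
    (hlim.norm.pow 2).mul ((Real.continuous_exp.tendsto _).comp
      (tendsto_inv_atTop_zero.const_mul _))
  rw [norm_zero, zero_pow two_ne_zero, zero_mul] at h1
  have h2 : ‖z ρ‖ ^ 2 * Real.exp (-(2 * C) * ρ⁻¹) ≤ 0 := by
    refine ge_of_tendsto h1 ?_
    filter_upwards [eventually_ge_atTop ρ] with t ht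
    exact hmono hρ (hρ.trans_le ht) ht
  have h3 : ‖z ρ‖ ^ 2 ≤ 0 := nonpos_of_mul_nonpos_left h2 (Real.exp_pos _)
  simpa using le_antisymm h3 (sq_nonneg _)

/-- Asymptotics at infinity of solutions of Bessel's equation. -/
theorem exists_bessel_asymptotics {F F' F'' : ℝ → ℝ} {s ω : ℝ} (hω : 0 < ω)
    (h1 : ∀ ρ, HasDerivAt F (F' ρ) ρ) (h2 : ∀ ρ, HasDerivAt F' (F'' ρ) ρ)
    (hode : ∀ ρ, 0 < ρ → F'' ρ + 2 * s / ρ * F' ρ = -ω ^ 2 * F ρ) :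
    ∃ W : ℂ, (W = 0 → F 0 = 0) ∧
      Tendsto (fun ρ : ℝ => ρ ^ s * F ρ - (W * Complex.exp ((ω * ρ : ℝ) * Complex.I)).im) atTop
        (nhds 0) := by
  set u : ℝ → ℝ := fun ρ => ρ ^ s * F ρ with hu
  set v : ℝ → ℝ := fun ρ => ρ ^ s * (F' ρ + s / ρ * F ρ) with hv
  set κ : ℝ := s * (s - 1) with hκ
  have hpow : ∀ ρ : ℝ, 0 < ρ → HasDerivAt (fun ρ : ℝ => ρ ^ s) (ρ ^ s * (s / ρ)) ρ := fun ρ hρ => by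
    refine (Real.hasDerivAt_rpow_const (Or.inl hρ.ne')).congr_deriv ?_
    rw [Real.rpow_sub_one hρ.ne']; ring
  have hu' : ∀ ρ, 0 < ρ → HasDerivAt u (v ρ) ρ := fun ρ hρ =>
    ((hpow ρ hρ).mul (h1 ρ)).congr_deriv (by rw [hv]; ring)
  have hv' : ∀ ρ, 0 < ρ → HasDerivAt v (-ω ^ 2 * u ρ + κ / ρ ^ 2 * u ρ) ρ := fun ρ hρ => by
    have hdiv : HasDerivAt (fun ρ : ℝ => s / ρ) (-s / ρ ^ 2) ρ := by
      simpa [div_eq_mul_inv, neg_mul] using (hasDerivAt_inv hρ.ne').const_mul s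
    refine ((hpow ρ hρ).mul ((h2 ρ).add (hdiv.mul (h1 ρ)))).congr_deriv ?_
    have h3 : F'' ρ = -ω ^ 2 * F ρ - 2 * s / ρ * F' ρ := by linarith [hode ρ hρ]
    simp only [hu, hκ, h3, Pi.add_apply, Pi.mul_apply]
    field_simp
    ring
  have hexp : ∀ ρ : ℝ, HasDerivAt (fun ρ : ℝ => Complex.exp ((-(ω * ρ) : ℝ) * Complex.I))
      (Complex.exp ((-(ω * ρ) : ℝ) * Complex.I) * (-ω * Complex.I)) ρ := fun ρ => by
    have h3 : HasDerivAt (fun ρ : ℝ => -(ω * ρ)) (-ω) ρ := by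
      simpa using (hasDerivAt_id ρ).const_mul (-ω)
    simpa using (h3.ofReal_comp.mul_const Complex.I).cexp
  -- The substitution `u = ρ^s F` removes the first-order term, giving `u'' = (-ω² + κ/ρ²) u`. For
  -- `κ = 0` the quantity `z` would be constant; in general its derivative contains only the `κ/ρ²`
  -- term.
  set z : ℝ → ℂ := fun ρ => Complex.exp ((-(ω * ρ) : ℝ) * Complex.I) *
    (v ρ + ω * Complex.I * u ρ) with hz
  set z' : ℝ → ℂ := fun ρ => Complex.exp ((-(ω * ρ) : ℝ) * Complex.I) *
    ((κ / ρ ^ 2 * u ρ : ℝ) : ℂ) with hz'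
  have hzd : ∀ ρ, 0 < ρ → HasDerivAt z (z' ρ) ρ := fun ρ hρ => by
    have h3 := (hv' ρ hρ).ofReal_comp.add ((hu' ρ hρ).ofReal_comp.const_mul (ω * Complex.I))
    refine ((hexp ρ).mul h3).congr_deriv ?_
    simp only [hz', Pi.add_apply]
    push_cast
    linear_combination (-Complex.exp (-((ω : ℂ) * ρ) * Complex.I)) * ω ^ 2 * u ρ * Complex.I_sq
  have hnorm : ∀ ρ : ℝ, ‖Complex.exp ((-(ω * ρ) : ℝ) * Complex.I)‖ = 1 := fun ρ =>
    Complex.norm_exp_ofReal_mul_I _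
  have huz : ∀ ρ, ω * |u ρ| ≤ ‖z ρ‖ := fun ρ => by
    rw [hz, norm_mul, hnorm, one_mul]
    refine le_trans (le_of_eq ?_) (Complex.abs_im_le_norm _)
    simp [abs_mul, abs_of_pos hω]
  have hzle : ∀ ρ, 0 < ρ → ‖z' ρ‖ ≤ |κ| / ω * ‖z ρ‖ / ρ ^ 2 := fun ρ hρ => by
    rw [hz', norm_mul, hnorm, one_mul, Complex.norm_real, Real.norm_eq_abs, abs_mul, abs_div,
      abs_of_pos (pow_pos hρ 2)]
    calc |κ| / ρ ^ 2 * |u ρ| = |κ| / ω * (ω * |u ρ|) / ρ ^ 2 := by field_simp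
      _ ≤ _ := by gcongr; exact huz ρ
  obtain ⟨W, hW, hW0⟩ := exists_tendsto_of_norm_deriv_le (by positivity) hzd hzle
  have hω' : (ω : ℂ) ≠ 0 := by exact_mod_cast hω.ne'
  refine ⟨W / ω, fun h => ?_, ?_⟩
  · have hz0 := hW0 (by simpa [hω.ne'] using h)
    have hF0 : ∀ ρ, 0 < ρ → F ρ = 0 := fun ρ hρ => by
      have h3 := huz ρ
      rw [hz0 ρ hρ, norm_zero] at h3
      have h4 : u ρ = 0 := by
        rw [← abs_nonpos_iff]; exact nonpos_of_mul_nonpos_right h3 hω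
      exact (mul_eq_zero.1 h4).resolve_left (Real.rpow_pos_of_pos hρ s).ne'
    have h3 : Tendsto F (nhdsWithin 0 (Set.Ioi 0)) (nhds (F 0)) :=
      (h1 0).continuousAt.tendsto.mono_left nhdsWithin_le_nhds
    refine tendsto_nhds_unique h3 (tendsto_const_nhds.congr' ?_)
    filter_upwards [self_mem_nhdsWithin] with ρ hρ
    exact (hF0 ρ hρ).symm
  · have h3 : ∀ ρ : ℝ, ρ ^ s * F ρ - (W / ω * Complex.exp ((ω * ρ : ℝ) * Complex.I)).im =
        ((z ρ - W) / ω * Complex.exp ((ω * ρ : ℝ) * Complex.I)).im := fun ρ => by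
      have h4 : z ρ / ω * Complex.exp ((ω * ρ : ℝ) * Complex.I) =
          (v ρ + ω * Complex.I * u ρ) / ω := by
        have h5 : Complex.exp ((-(ω * ρ) : ℝ) * Complex.I) *
            Complex.exp ((ω * ρ : ℝ) * Complex.I) = 1 := by
          rw [← Complex.exp_add]; simp
        simp only [hz]
        linear_combination (v ρ + ω * Complex.I * u ρ) / ω * h5
      rw [sub_div, sub_mul, Complex.sub_im, h4]
      congr 1
      rw [Complex.div_ofReal_im]
      simp [hu]
      field_simp
    simp only [h3]
    have h4 : Tendsto (fun ρ => ‖(z ρ - W) / ω‖) atTop (nhds 0) := by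
      have := ((hW.sub_const W).div_const (ω : ℂ)).norm
      simpa using this
    refine squeeze_zero_norm (fun ρ => ?_) h4
    refine (Complex.abs_im_le_norm _).trans ?_
    rw [norm_mul, Complex.norm_exp_ofReal_mul_I, mul_one]

/-- The value of the transform at the origin is the total mass, so a vanishing amplitude means a
vanishing measure. -/
theorem IsRadial.exists_sphere_asymptotics [IsFiniteMeasure μ] (hrad : IsRadial μ) {r : ℝ}
    (hr0 : 0 < r) (hr : ∀ᵐ x ∂μ, ‖x‖ = r) (i₀ : Fin d) :
    ∃ W : ℂ, (W = 0 → μ = 0) ∧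
      Tendsto (fun ρ : ℝ => ρ ^ (((d : ℝ) - 1) / 2) * cosTransform μ (fun _ => 1)
        (ρ • EuclideanSpace.single i₀ (1 : ℝ)) -
          (W * Complex.exp ((2 * Real.pi * r * ρ : ℝ) * Complex.I)).im) atTop (nhds 0) := by
  obtain ⟨F', F'', h1, h2, h3⟩ := hrad.sphere_ode hr i₀
  have hω : 0 < 2 * Real.pi * r := by positivity
  obtain ⟨W, hW, ht⟩ := exists_bessel_asymptotics (s := ((d : ℝ) - 1) / 2) hω h1 h2
    fun ρ hρ => by rw [mul_div_cancel₀ _ two_ne_zero]; exact h3 ρ hρ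
  refine ⟨W, fun h => ?_, ht⟩
  have := hW h
  simpa [cosTransform, measureReal_eq_zero_iff] using this

/-! ### Independence of oscillations and exact decay for finitely many spheres -/

/-- A sum of harmonic oscillations with distinct frequencies that tends to zero is zero. -/
theorem eq_zero_of_tendsto_sum_oscillations (Z : Finset ℝ) (hZ : ∀ r ∈ Z, 0 ≤ r)
    (g : ℝ → ℝ → ℝ)
    (hg : ∀ r ∈ Z, ∀ ρ s, g r (ρ + s) + g r (ρ - s) = 2 * Real.cos (2 * Real.pi * r * s) * g r ρ)
    (h : Tendsto (fun ρ => ∑ r ∈ Z, g r ρ) atTop (nhds 0)) : ∀ r ∈ Z, ∀ ρ, g r ρ = 0 := by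
  have hsingle : ∀ (r : ℝ) (g : ℝ → ℝ),
      (∀ ρ s, g (ρ + s) + g (ρ - s) = 2 * Real.cos (2 * Real.pi * r * s) * g ρ) →
      Tendsto g atTop (nhds 0) → ∀ ρ, g ρ = 0 := by
    intro r g hg ht ρ
    -- The addition formula recovers `g ρ` from values arbitrarily far out, which tend to zero.
    have h1 : ∀ s, g ρ = 2 * Real.cos (2 * Real.pi * r * s) * g (ρ + s) - g (ρ + 2 * s) :=
      fun s => by
        have := hg (ρ + s) s
        rw [add_sub_cancel_right, show ρ + s + s = ρ + 2 * s by ring] at this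
        linarith
    have h2 : Tendsto (fun s => 2 * |g (ρ + s)| + |g (ρ + 2 * s)|) atTop (nhds 0) := by
      have h3 := (ht.comp (tendsto_atTop_add_const_left atTop ρ tendsto_id)).abs
      have h4 := (ht.comp (tendsto_atTop_add_const_left atTop ρ
        (tendsto_id.const_mul_atTop (zero_lt_two (α := ℝ))))).abs
      simpa using (h3.const_mul 2).add h4
    rw [← abs_nonpos_iff]
    refine ge_of_tendsto h2 (.of_forall fun s => ?_)
    rw [h1 s]
    refine (abs_sub _ _).trans ?_
    rw [abs_mul, abs_mul, abs_two]
    have := Real.abs_cos_le_one (2 * Real.pi * r * s)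
    gcongr
    linarith
  induction Z using Finset.induction_on generalizing g with
  | empty => simp
  | insert r₁ Z hr₁ ih =>
    have hg1 := hg r₁ (Finset.mem_insert_self _ _)
    set S := ∑ r ∈ insert r₁ Z, r with hS
    have hS0 : 0 ≤ S := Finset.sum_nonneg hZ
    -- This shift puts every phase `2πrs` in `[0, π]`, where cosine is injective; nonnegativity of
    -- the frequencies is used here.
    set s : ℝ := 1 / (2 * (1 + S)) with hs
    have hmem : ∀ r ∈ insert r₁ Z, 2 * Real.pi * r * s ∈ Set.Icc 0 Real.pi := fun r hr => by
      have h0 := hZ r hr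
      have hle : r ≤ S := Finset.single_le_sum hZ hr
      refine ⟨by positivity, ?_⟩
      rw [hs, mul_one_div, div_le_iff₀ (by positivity)]
      nlinarith [Real.pi_pos]
    have hs0 : s ≠ 0 := by positivity
    have hne : ∀ r ∈ Z, 2 * Real.cos (2 * Real.pi * r * s) -
        2 * Real.cos (2 * Real.pi * r₁ * s) ≠ 0 := fun r hr h0 => by
      have h1 := Real.injOn_cos (hmem r (Finset.mem_insert_of_mem hr))
        (hmem r₁ (Finset.mem_insert_self _ _)) (by linarith)
      have h2 : r = r₁ :=
        mul_left_cancel₀ Real.two_pi_pos.ne' (mul_right_cancel₀ hs0 h1)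
      exact hr₁ (h2 ▸ hr)
    have hZ0 : ∀ r ∈ Z, ∀ ρ, g r ρ = 0 := by
      -- Adding the translates by `±s` and subtracting `2 cos(2πr₁s)` times the sum annihilates the
      -- `r₁` term and rescales each other term by a nonzero factor.
      have h1 := ih (fun r hr => hZ r (Finset.mem_insert_of_mem hr))
        (fun r ρ => (2 * Real.cos (2 * Real.pi * r * s) -
          2 * Real.cos (2 * Real.pi * r₁ * s)) * g r ρ)
        (fun r hr ρ t => by
          rw [← mul_add, hg r (Finset.mem_insert_of_mem hr)]; ring) (by
          have h2 := h.comp (tendsto_atTop_add_const_right atTop s tendsto_id)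
          have h3 := h.comp (tendsto_atTop_add_const_right atTop (-s) tendsto_id)
          have h4 := (h2.add h3).sub (h.const_mul (2 * Real.cos (2 * Real.pi * r₁ * s)))
          simp only [mul_zero, add_zero, sub_zero] at h4
          refine h4.congr fun ρ => ?_
          simp only [Function.comp_apply, id, ← sub_eq_add_neg]
          rw [← Finset.sum_add_distrib, Finset.mul_sum, ← Finset.sum_sub_distrib,
            Finset.sum_insert hr₁]
          rw [hg1, sub_self, zero_add]
          refine Finset.sum_congr rfl fun r hr => ?_
          rw [hg r (Finset.mem_insert_of_mem hr)]
          ring)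
      exact fun r hr ρ => (mul_eq_zero.1 (h1 r hr ρ)).resolve_left (hne r hr)
    intro r hr
    rcases Finset.mem_insert.1 hr with rfl | hr
    · refine hsingle r _ hg1 (h.congr fun ρ => ?_)
      rw [Finset.sum_insert hr₁, Finset.sum_eq_zero fun r' hr' => hZ0 r' hr' ρ, add_zero]
    · exact hZ0 r hr

theorem IsRadial.restrict_sphere (hrad : IsRadial μ) (r : ℝ) :
    IsRadial (μ.restrict (Metric.sphere 0 r)) := fun R => by
  have h := (hrad.measurePreserving R).restrict_preimage
    (Metric.isClosed_sphere (x := (0 : EuclideanSpace ℝ (Fin d))) (ε := r)).measurableSet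
  rw [show R ⁻¹' Metric.sphere 0 r = Metric.sphere 0 r by ext x; simp] at h
  exact h.map_eq

theorem oscillation_eq (W : ℂ) (r ρ s : ℝ) :
    (W * Complex.exp ((2 * Real.pi * r * (ρ + s) : ℝ) * Complex.I)).im +
      (W * Complex.exp ((2 * Real.pi * r * (ρ - s) : ℝ) * Complex.I)).im =
    2 * Real.cos (2 * Real.pi * r * s) *
      (W * Complex.exp ((2 * Real.pi * r * ρ : ℝ) * Complex.I)).im := by
  simp only [Complex.mul_im, Complex.exp_ofReal_mul_I_re, Complex.exp_ofReal_mul_I_im, mul_add,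
    mul_sub, Real.cos_add, Real.cos_sub, Real.sin_add, Real.sin_sub]
  ring

/-- The values at `0` and at a quarter period `1 / (4r)` are the imaginary and real parts of `W`. -/
theorem eq_zero_of_oscillation_eq_zero {W : ℂ} {r : ℝ} (hr : 0 < r)
    (h : ∀ ρ : ℝ, (W * Complex.exp ((2 * Real.pi * r * ρ : ℝ) * Complex.I)).im = 0) : W = 0 := by
  have h1 := h 0
  have h2 := h (1 / (4 * r))
  rw [show 2 * Real.pi * r * (1 / (4 * r)) = Real.pi / 2 by field_simp; ring] at h2
  simp only [Complex.mul_im, Complex.exp_ofReal_mul_I_re, Complex.exp_ofReal_mul_I_im] at h1 h2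
  simp at h1 h2
  exact Complex.ext h2 h1

/-- The exact decay rate of the Fourier transform of a radial measure carried by finitely many
spheres. -/
theorem IsRadial.decay_of_finite_spheres [IsFiniteMeasure μ] (hrad : IsRadial μ) (hμ : μ ≠ 0)
    (Z : Finset ℝ) (hZpos : ∀ r ∈ Z, 0 < r) (hZ : ∀ᵐ x ∂μ, ‖x‖ ∈ insert 0 Z) (i₀ : Fin d)
    (hdecay : Tendsto (fun ρ : ℝ => cosTransform μ (fun _ => 1)
      (ρ • EuclideanSpace.single i₀ (1 : ℝ))) atTop (nhds 0)) :
    (∃ B, ∀ᶠ ρ : ℝ in atTop, |ρ ^ (((d : ℝ) - 1) / 2) * cosTransform μ (fun _ => 1)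
      (ρ • EuclideanSpace.single i₀ (1 : ℝ))| ≤ B) ∧
    ¬ Tendsto (fun ρ : ℝ => ρ ^ (((d : ℝ) - 1) / 2) * cosTransform μ (fun _ => 1)
      (ρ • EuclideanSpace.single i₀ (1 : ℝ))) atTop (nhds 0) := by
  set e : EuclideanSpace ℝ (Fin d) := EuclideanSpace.single i₀ (1 : ℝ)
  set s : ℝ := ((d : ℝ) - 1) / 2 with hs
  set ν : ℝ → Measure (EuclideanSpace ℝ (Fin d)) := fun r => μ.restrict (Metric.sphere 0 r)
  have h0Z : (0 : ℝ) ∉ Z := fun h => lt_irrefl _ (hZpos 0 h)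
  have hd : 1 ≤ d := i₀.pos
  have hdecomp : ∀ ξ, cosTransform μ (fun _ => 1) ξ =
      ∑ r ∈ insert 0 Z, cosTransform (ν r) (fun _ => 1) ξ := by
    intro ξ
    have h1 : μ.restrict (⋃ r ∈ insert 0 Z, Metric.sphere 0 r) = μ :=
      Measure.restrict_eq_self_of_ae_mem (hZ.mono fun x hx => by
        simp only [Set.mem_iUnion]; exact ⟨‖x‖, hx, by simp⟩)
    nth_rewrite 1 [← h1]
    simp only [cosTransform, ν]
    refine integral_biUnion_finset _ (fun r _ => Metric.isClosed_sphere.measurableSet) ?_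
      fun r _ => (integrable_mul_cos (integrable_const 1) ξ).integrableOn
    intro r _ r' _ hne
    refine Set.disjoint_left.2 fun x hx hx' => hne ?_
    rw [mem_sphere_zero_iff_norm] at hx hx'
    rw [← hx, ← hx']
  have hzero : ∀ ξ, cosTransform (ν 0) (fun _ => 1) ξ = μ.real {0} := by
    intro ξ
    simp [cosTransform, ν, measureReal_def]
  have hasym : ∀ r : ℝ, ∃ W : ℂ, 0 < r → (W = 0 → ν r = 0) ∧
      Tendsto (fun ρ : ℝ => ρ ^ s * cosTransform (ν r) (fun _ => 1) (ρ • e) -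
          (W * Complex.exp ((2 * Real.pi * r * ρ : ℝ) * Complex.I)).im) atTop (nhds 0) := by
    intro r
    by_cases hr : 0 < r
    · obtain ⟨W, hW⟩ := (hrad.restrict_sphere r).exists_sphere_asymptotics hr (by
        filter_upwards [ae_restrict_mem Metric.isClosed_sphere.measurableSet] with x hx
        simpa using hx) i₀
      exact ⟨W, fun _ => hW⟩
    · exact ⟨0, fun h => absurd h hr⟩
  choose W hW using hasym
  set g : ℝ → ℝ → ℝ := fun r ρ =>
    (W r * Complex.exp ((2 * Real.pi * r * ρ : ℝ) * Complex.I)).im with hg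
  have hgle : ∀ r ρ, |g r ρ| ≤ ‖W r‖ := fun r ρ => by
    refine (Complex.abs_im_le_norm _).trans ?_
    rw [norm_mul, Complex.norm_exp_ofReal_mul_I, mul_one]
  have hsum : Tendsto (fun ρ : ℝ => ∑ r ∈ Z,
      (ρ ^ s * cosTransform (ν r) (fun _ => 1) (ρ • e) - g r ρ)) atTop (nhds 0) := by
    have := tendsto_finsetSum Z fun r hr => (hW r (hZpos r hr)).2
    rwa [Finset.sum_const_zero] at this
  -- For `d = 1` nothing decays, and the atom counts as an oscillation of frequency `0`. For `d ≥ 2`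
  -- the sphere terms tend to zero, so the constant contributed by the atom must vanish.
  have hatom : μ.real {0} = 0 := by
    rcases hd.eq_or_lt with hd1 | hd1
    · have hs0 : s = 0 := by rw [hs, ← hd1]; simp
      have h1 : Tendsto (fun ρ : ℝ => ∑ r ∈ insert 0 Z,
          (if r = 0 then μ.real {0} else g r ρ)) atTop (nhds 0) := by
        have h2 := hdecay.sub hsum
        rw [sub_zero] at h2
        refine h2.congr fun ρ => ?_
        rw [hdecomp, Finset.sum_insert h0Z, Finset.sum_insert h0Z, hzero, if_pos rfl, hs0,
          Finset.sum_congr rfl fun r hr => if_neg (hZpos r hr).ne']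
        simp
        ring
      refine eq_zero_of_tendsto_sum_oscillations (insert 0 Z) (fun r hr => ?_)
        (fun r ρ => if r = 0 then μ.real {0} else g r ρ) (fun r _ ρ t => ?_) h1 0
        (Finset.mem_insert_self _ _) 0 |> fun h => by simpa using h
      · rcases Finset.mem_insert.1 hr with rfl | hr
        exacts [le_rfl, (hZpos r hr).le]
      · by_cases hr : r = 0
        · simp [hr, two_mul]
        · simp only [hr, if_false]
          exact oscillation_eq _ _ _ _
    · have hs0 : 0 < s := by
        have : (1 : ℝ) < d := by exact_mod_cast hd1
        rw [hs]; linarith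
      have h1 : ∀ r ∈ Z, Tendsto (fun ρ : ℝ => cosTransform (ν r) (fun _ => 1) (ρ • e)) atTop
          (nhds 0) := by
        intro r hr
        have hinv : Tendsto (fun ρ : ℝ => (ρ ^ s)⁻¹) atTop (nhds 0) :=
          (tendsto_rpow_atTop hs0).inv_tendsto_atTop
        have h2 : Tendsto (fun ρ : ℝ => (ρ ^ s)⁻¹ *
            (ρ ^ s * cosTransform (ν r) (fun _ => 1) (ρ • e) - g r ρ)) atTop (nhds 0) := by
          have h3 := hinv.mul (hW r (hZpos r hr)).2
          rwa [mul_zero] at h3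
        have h3 : Tendsto (fun ρ : ℝ => (ρ ^ s)⁻¹ * g r ρ) atTop (nhds 0) := by
          refine hinv.zero_mul_isBoundedUnder_le ?_
          exact isBoundedUnder_of ⟨‖W r‖, hgle r⟩
        have h4 := h2.add h3
        rw [add_zero] at h4
        refine h4.congr' ?_
        filter_upwards [eventually_gt_atTop 0] with ρ hρ
        have := (Real.rpow_pos_of_pos hρ s).ne'
        field_simp
        ring
      have h2 := hdecay.sub (tendsto_finsetSum Z h1)
      simp only [Finset.sum_const_zero, sub_zero] at h2
      refine tendsto_nhds_unique (tendsto_const_nhds.congr fun ρ => ?_) h2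
      rw [hdecomp, Finset.sum_insert h0Z, hzero, add_sub_cancel_right]
  have hmain : Tendsto (fun ρ : ℝ => ρ ^ s * cosTransform μ (fun _ => 1) (ρ • e) -
      ∑ r ∈ Z, g r ρ) atTop (nhds 0) := by
    refine hsum.congr fun ρ => ?_
    rw [hdecomp, Finset.sum_insert h0Z, hzero, hatom, zero_add, Finset.mul_sum,
      Finset.sum_sub_distrib]
  constructor
  · refine ⟨1 + ∑ r ∈ Z, ‖W r‖, ?_⟩
    filter_upwards [hmain.abs.eventually (gt_mem_nhds (by simp : |(0 : ℝ)| < 1))] with ρ hρ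
    have h1 : |∑ r ∈ Z, g r ρ| ≤ ∑ r ∈ Z, ‖W r‖ :=
      (Finset.abs_sum_le_sum_abs _ _).trans (Finset.sum_le_sum fun r _ => hgle r ρ)
    have h2 := abs_add_le (ρ ^ s * cosTransform μ (fun _ => 1) (ρ • e) - ∑ r ∈ Z, g r ρ)
      (∑ r ∈ Z, g r ρ)
    rw [sub_add_cancel] at h2
    linarith
  · intro hlim
    have h1 := hlim.sub hmain
    simp only [sub_sub_cancel, sub_zero] at h1
    have h2 := eq_zero_of_tendsto_sum_oscillations Z (fun r hr => (hZpos r hr).le) g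
      (fun r _ ρ t => oscillation_eq _ _ _ _) h1
    have h3 : ∀ r ∈ Z, ν r = 0 := fun r hr =>
      (hW r (hZpos r hr)).1 (eq_zero_of_oscillation_eq_zero (hZpos r hr) (h2 r hr))
    have h4 := hdecomp 0
    rw [Finset.sum_insert h0Z, hzero, hatom, Finset.sum_eq_zero fun r hr => by
      rw [h3 r hr]; simp [cosTransform]] at h4
    simp [cosTransform, measureReal_eq_zero_iff] at h4
    exact hμ h4

/-! ### Decay limsup and structure of the extremizer -/

theorem decayLimsup_lt_top_of_eventually_le {γ B : ℝ}
    (h : ∀ᶠ ξ in cobounded (EuclideanSpace ℝ (Fin d)), ‖measureFourier μ ξ‖ * ‖ξ‖ ^ γ ≤ B) :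
    decayLimsup μ γ < ∞ :=
  (limsup_le_of_le (h := h.mono fun _ hξ => ENNReal.ofReal_le_ofReal hξ)).trans_lt
    ENNReal.ofReal_lt_top

theorem tendsto_of_decayLimsup_eq_zero {γ : ℝ} (h : decayLimsup μ γ = 0) :
    Tendsto (fun ξ => ‖measureFourier μ ξ‖ * ‖ξ‖ ^ γ) (cobounded (EuclideanSpace ℝ (Fin d)))
      (nhds 0) := by
  have h1 : Tendsto (fun ξ => ENNReal.ofReal (‖measureFourier μ ξ‖ * ‖ξ‖ ^ γ))
      (cobounded (EuclideanSpace ℝ (Fin d))) (nhds 0) :=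
    tendsto_of_le_liminf_of_limsup_le bot_le h.le
  have h2 := (ENNReal.tendsto_toReal ENNReal.zero_ne_top).comp h1
  refine h2.congr fun ξ => ?_
  exact ENNReal.toReal_ofReal (by positivity)

/-- A nonzero sup norm is required because `0 * ∞ = 0` in `ℝ≥0∞` would hide an infinite moment. -/
theorem moment_ne_top_of_quotient_ne_top [IsFiniteMeasure μ] {α β : ℝ} (hα : 0 < α) (hβ : 0 < β)
    (hfin : weightedSupNorm β μ ≠ ∞) (h0 : weightedSupNorm β μ ≠ 0)
    (h : uncertaintyQuotient α β μ ≠ ∞) : moment α μ ≠ ∞ := by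
  intro hm
  apply h
  rw [uncertaintyQuotient, if_neg hfin, hm, ENNReal.top_rpow_of_pos hβ,
    ENNReal.mul_top (by simp [h0, hα.not_gt, hfin]), ENNReal.top_div_of_ne_top]
  exact ENNReal.rpow_ne_top_of_nonneg (by positivity) (by simp)

theorem integrable_of_moment_ne_top {α : ℝ} (hα : 0 < α) (h : moment α μ ≠ ∞) :
    Integrable (fun x => ‖x‖ ^ α) μ :=
  (lintegral_ofReal_ne_top_iff_integrable
    (Real.continuous_rpow_const hα.le |>.comp continuous_norm).aestronglyMeasurable
    (.of_forall fun x => Real.rpow_nonneg (norm_nonneg x) α)).1 h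

/-- An extremizer whose weighted Fourier transform vanishes at infinity is carried by finitely
many spheres. -/
theorem IsRadial.exists_finite_spheres [IsFiniteMeasure μ] {α β : ℝ} (hα : 0 < α) (hβ : 0 < β)
    (hrad : IsRadial μ) (hμ : μ ≠ 0) (hfin : weightedSupNorm β μ ≠ ∞)
    (hM : 0 < (weightedSupNorm β μ).toReal) (hint : Integrable (fun x => ‖x‖ ^ α) μ)
    (hext : uncertaintyQuotient α β μ = optimalConstant α β d)
    (hlim : Tendsto (fun ξ => ‖measureFourier μ ξ‖ * ‖ξ‖ ^ β)
      (cobounded (EuclideanSpace ℝ (Fin d))) (nhds 0)) (i₀ : Fin d) :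
    ∃ Z : Finset ℝ, (∀ r ∈ Z, 0 < r) ∧ ∀ᵐ x ∂μ, ‖x‖ ∈ insert 0 Z := by
  set M := (weightedSupNorm β μ).toReal with hMdef
  have habs : ∀ ξ, |cosTransform μ (fun _ => 1) ξ * ‖ξ‖ ^ β| =
      ‖measureFourier μ ξ‖ * ‖ξ‖ ^ β := fun ξ => by
    rw [hrad.measureFourier_eq, Complex.norm_real, Real.norm_eq_abs, abs_mul,
      abs_of_nonneg (Real.rpow_nonneg (norm_nonneg ξ) β)]
  have hnn : (0 : EuclideanSpace ℝ (Fin d) → ℝ) ≤ fun x => ‖x‖ ^ α := fun x =>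
    Real.rpow_nonneg (norm_nonneg x) α
  rcases (integral_nonneg (μ := μ) hnn).eq_or_lt with hm0 | hmpos
  -- A zero moment means that `μ` sits at the origin; the multiplier argument needs a positive
  -- moment.
  · refine ⟨∅, by simp, ?_⟩
    have := (integral_eq_zero_iff_of_nonneg hnn hint).1 hm0.symm
    filter_upwards [this] with x hx
    have h1 : ‖x‖ = 0 := (Real.rpow_eq_zero (norm_nonneg x) hα.ne').1 hx
    simp [h1]
  -- Vanishing at infinity is used only here, to bound the near-maximum set.
  have hK : IsCompact {ξ | M / 2 ≤ |cosTransform μ (fun _ => 1) ξ * ‖ξ‖ ^ β|} := by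
    refine Metric.isCompact_of_isClosed_isBounded (isClosed_le continuous_const ?_) ?_
    · have h1 := continuous_cosTransform (μ := μ) (f := fun _ => 1) (integrable_const 1)
      have h2 : Continuous fun ξ : EuclideanSpace ℝ (Fin d) => ‖ξ‖ ^ β :=
        continuous_norm.rpow_const fun _ => Or.inr hβ.le
      exact (h1.mul h2).abs
    · rw [isBounded_def]
      filter_upwards [hlim.eventually (gt_mem_nhds (half_pos hM))] with ξ hξ
      simpa [habs] using hξ
  obtain ⟨K, hKc, w, Λ, a, b, hb, hae⟩ :=
    hrad.exists_multiplier hα hβ hμ hM hMdef hfin hint hmpos hext hK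
  set e : EuclideanSpace ℝ (Fin d) := EuclideanSpace.single i₀ (1 : ℝ)
  have he : ‖e‖ = 1 := by simp [e]
  have hcont : Continuous fun x : EuclideanSpace ℝ (Fin d) =>
      Λ (cosMap w x) + b * ‖x‖ ^ α - a := by
    have h1 := Λ.continuous.comp (continuous_cosMap w)
    have h2 : Continuous fun x : EuclideanSpace ℝ (Fin d) => ‖x‖ ^ α :=
      continuous_norm.rpow_const fun _ => Or.inr hα.le
    exact (h1.add (h2.const_mul _)).sub continuous_const
  have hray := hrad.ae_eq_zero_on_ray hcont hae he
  have hfinite : {r : ℝ | 0 < r ∧ Λ (cosMap w (r • e)) - a + b * r ^ α = 0}.Finite := by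
    refine finite_zeros_add_rpow (C := ‖Λ‖ * ‖w‖ + |a|)
      (fun r hr => (analyticOnNhd_clm_cosMap w Λ e r hr).sub analyticAt_const) (fun r => ?_) hα hb
    refine (abs_sub _ _).trans (add_le_add ((Λ.le_opNorm _).trans ?_) le_rfl)
    exact mul_le_mul_of_nonneg_left (norm_cosMap_le w _) (norm_nonneg Λ)
  refine ⟨hfinite.toFinset, fun r hr => ((Set.Finite.mem_toFinset _).1 hr).1, ?_⟩
  filter_upwards [hray] with x hx
  rw [Finset.mem_insert, Set.Finite.mem_toFinset]
  rcases (norm_nonneg x).eq_or_lt with h | h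
  · exact Or.inl h.symm
  · right
    refine ⟨h, ?_⟩
    rw [norm_smul, he, mul_one, norm_norm] at hx
    linarith

end FourierUncertainty

end

/-! ### The decay dichotomy -/

theorem mainTheorem4 (d : ℕ) (hd : 1 ≤ d) (α β : ℝ) (hα : 0 < α) (hβ : 0 < β)
    (μ : Measure (EuclideanSpace ℝ (Fin d))) [IsFiniteMeasure μ] (hμ : μ ≠ 0)
    (hrad : FourierUncertainty.IsRadial μ)
    (hext : FourierUncertainty.uncertaintyQuotient α β μ =
      FourierUncertainty.optimalConstant α β d) :
    (((d : ℝ) - 1) / 2 ≤ β →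
      0 < FourierUncertainty.decayLimsup μ β ∧ FourierUncertainty.decayLimsup μ β < ∞) ∧
    (β < ((d : ℝ) - 1) / 2 →
      ∃ γ ∈ ({β, ((d : ℝ) - 1) / 2} : Set ℝ),
        0 < FourierUncertainty.decayLimsup μ γ ∧ FourierUncertainty.decayLimsup μ γ < ∞) := by
  open FourierUncertainty in
  have hq : uncertaintyQuotient α β μ ≠ ∞ := hext ▸ (optimalConstant_lt_top hα hβ).ne
  have hfin : weightedSupNorm β μ ≠ ∞ := fun h => hq (if_pos h)
  have hM := weightedSupNorm_toReal_pos hd hμ hβ hfin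
  have htop : decayLimsup μ β < ∞ := decayLimsup_lt_top_of_eventually_le
    (.of_forall fun ξ => norm_measureFourier_mul_le hβ hfin ξ)
  by_cases h0 : decayLimsup μ β = 0
  swap
  · exact ⟨fun _ => ⟨pos_iff_ne_zero.2 h0, htop⟩,
      fun _ => ⟨β, by simp, pos_iff_ne_zero.2 h0, htop⟩⟩
  have hlim := tendsto_of_decayLimsup_eq_zero h0
  have hint : Integrable (fun x => ‖x‖ ^ α) μ := integrable_of_moment_ne_top hα
    (moment_ne_top_of_quotient_ne_top hα hβ hfin (fun h => by simp [h] at hM) hq)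
  let i₀ : Fin d := ⟨0, hd⟩
  obtain ⟨Z, hZpos, hZ⟩ := hrad.exists_finite_spheres hα hβ hμ hfin hM hint hext hlim i₀
  have hnorm : ∀ ρ : ℝ, 0 ≤ ρ → ‖ρ • EuclideanSpace.single i₀ (1 : ℝ)‖ = ρ := fun ρ hρ => by
    rw [norm_smul, PiLp.norm_single, norm_one, mul_one, Real.norm_of_nonneg hρ]
  have hray : Tendsto (fun ρ : ℝ => ρ • EuclideanSpace.single i₀ (1 : ℝ)) atTop
      (cobounded (EuclideanSpace ℝ (Fin d))) := by
    rw [← tendsto_norm_atTop_iff_cobounded]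
    exact tendsto_id.congr' ((eventually_ge_atTop 0).mono fun ρ hρ => (hnorm ρ hρ).symm)
  have habs : ∀ γ : ℝ, ∀ ξ, ‖measureFourier μ ξ‖ * ‖ξ‖ ^ γ =
      |‖ξ‖ ^ γ * cosTransform μ (fun _ => 1) (‖ξ‖ • EuclideanSpace.single i₀ (1 : ℝ))| :=
    fun γ ξ => by
      rw [hrad.measureFourier_eq, Complex.norm_real, Real.norm_eq_abs, abs_mul,
        abs_of_nonneg (Real.rpow_nonneg (norm_nonneg ξ) γ), mul_comm,
        hrad.cosTransform_one_eq_of_norm_eq (hnorm ‖ξ‖ (norm_nonneg ξ))]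
  have hto : ∀ γ : ℝ, Tendsto (fun ξ => ‖measureFourier μ ξ‖ * ‖ξ‖ ^ γ)
      (cobounded (EuclideanSpace ℝ (Fin d))) (nhds 0) →
      Tendsto (fun ρ : ℝ => ρ ^ γ * cosTransform μ (fun _ => 1)
        (ρ • EuclideanSpace.single i₀ (1 : ℝ))) atTop (nhds 0) := fun γ h => by
    rw [tendsto_zero_iff_abs_tendsto_zero]
    refine (h.comp hray).congr' ?_
    filter_upwards [eventually_ge_atTop 0] with ρ hρ
    simp only [Function.comp_apply, habs, hnorm ρ hρ]
  have hmono : ∀ γ : ℝ, γ ≤ β → Tendsto (fun ξ => ‖measureFourier μ ξ‖ * ‖ξ‖ ^ γ)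
      (cobounded (EuclideanSpace ℝ (Fin d))) (nhds 0) := fun γ hγ => by
    refine squeeze_zero' (.of_forall fun ξ => by positivity) ?_ hlim
    filter_upwards [tendsto_norm_cobounded_atTop.eventually_ge_atTop 1] with ξ hξ
    gcongr
  -- Exponent `0` gives plain decay of the transform, which rules out an atom at the origin.
  have hdecay := hto 0 (hmono 0 hβ.le)
  simp only [Real.rpow_zero, one_mul] at hdecay
  obtain ⟨⟨B, hB⟩, hne⟩ := hrad.decay_of_finite_spheres hμ Z hZpos hZ i₀ hdecay
  -- If `(d-1)/2 ≤ β`, the vanishing `β`-limsup also forces the limit with exponent `(d-1)/2` to be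
  -- zero, contradicting `hne`.
  refine ⟨fun h => absurd (hto _ (hmono _ h)) hne, fun _ => ⟨((d : ℝ) - 1) / 2, by simp, ?_, ?_⟩⟩
  · exact pos_iff_ne_zero.2 fun h => hne (hto _ (tendsto_of_decayLimsup_eq_zero h))
  · refine decayLimsup_lt_top_of_eventually_le (B := B) ?_
    filter_upwards [tendsto_norm_cobounded_atTop.eventually hB] with ξ hξ
    rw [habs]
    exact hξ
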